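/- Let $g\ge 2$, let $S$ be a closed orientable surface of genus $g$, obtained from a $4g$-gon by gluing its sides according to the word $\prod_{i=1}^g a_ib_ia_i^{-1}b_i^{-1}$, so that the sides give loops $a_1,b_1,\dots,a_g,b_g$ generating $\pi_1(S)$, and let $G$ be a finitely presented group. Covers are path connected; a cover $p:\tilde S\to S$ is regular if its deck transformation group $D$ acts transitively on every fibre. If $e_0\in\tilde S$ is a base point, a loop $\gamma$ at $p(e_0)$ determines the deck transformation $\varphi(\gamma)\in D$ that takes $e_0$ to the endpoint of the lift of $\gamma$ starting at $e_0$. 0. For every regular cover $p:\tilde S\to S$ and every $e_0\in\tilde S$, $\varphi$ is a well-defined surjective homomorphism $\pi_1(S,p(e_0))\to D$ with kernel $p_*\pi_1(\tilde S,e_0)$; that is, $D$ is the quotient $\pi_1(S)/\pi_1(\tilde S)$. 1. $G$ embeds in the deck transformation group $D$ of some regular cover of $S$, and hence in a quotient of $\pi_1(S)$; moreover the cover can be chosen so that $D$ is generated by two elements. 2. For every $x\in G$ with $x\neq 1$, there are a regular cover of $S$ with deck transformation group $D$, a base point of the cover, and an embedding $\iota:G\to D$, such that $\iota(x)=\varphi(a_1)$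 and $D$ is generated by $\iota(x)$ and one further element. 3. If $G$ is generated by $x_1,\dots,x_g$ (repetitions and trivial elements are allowed, so this means that $G$ can be generated by at most $g$ elements), then there are a regular cover of $S$ with deck transformation group $D$, a base point of the cover, and an isomorphism $\iota:G\to D$, such that $\varphi(a_i)=\iota(x_i)$ and $\varphi(b_i)=1$ for $i=1,\dots,g$. In particular $G$ is itself a quotient of $\pi_1(S)$. -/

import Mathlib

open scoped unitInterval

universe u v

noncomputable section

/-- The closed unit disc, regarded as a polygon with `4 * g` sides. -/
abbrev Disc : Type := Metric.closedBall (0 : ℂ) 1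

/-- The point of the unit circle at angle `2 * π * t / (4 * g)`. The integers `t` give the `4 * g`
corners of the polygon, and the `k`-th side consists of the points with `t ∈ [k, k + 1]`. -/
def boundaryPoint (g : ℕ) (t : ℝ) : Disc :=
  ⟨Circle.exp (2 * Real.pi * t / (4 * g)), mem_closedBall_zero_iff.2 (Circle.norm_coe _).le⟩

/-- The gluing of the sides of the `4 * g`-gon according to the boundary word
`a₀ b₀ a₀⁻¹ b₀⁻¹ a₁ b₁ a₁⁻¹ b₁⁻¹ ⋯`. -/
inductive SideGluing (g : ℕ) : Disc → Disc → Prop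
  | a (i : Fin g) (s : I) :
      SideGluing g (boundaryPoint g (4 * (i : ℕ) + (s : ℝ)))
        (boundaryPoint g (4 * (i : ℕ) + 3 - (s : ℝ)))
  | b (i : Fin g) (s : I) :
      SideGluing g (boundaryPoint g (4 * (i : ℕ) + 1 + (s : ℝ)))
        (boundaryPoint g (4 * (i : ℕ) + 4 - (s : ℝ)))

/-- The standard closed orientable surface of genus `g` (for `g ≥ 1`): the quotient, with the
quotient topology, of the `4 * g`-gon by the equivalence relation generated by the gluing of its
sides. -/
def StandardSurface (g : ℕ) : Type := Quot (SideGluing g)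

instance (g : ℕ) : TopologicalSpace (StandardSurface g) :=
  inferInstanceAs (TopologicalSpace (Quot (SideGluing g)))

theorem continuous_boundaryPoint (g : ℕ) : Continuous (boundaryPoint g) :=
  Continuous.subtype_mk (by fun_prop) _

/-- The standard generator `aᵢ`: the image in the surface of the `4 * i`-th side. All corners of
the polygon become one point of the surface, so this is a loop at that point. -/
def loopA (g : ℕ) (i : Fin g) : C(I, StandardSurface g) where
  toFun s := Quot.mk _ (boundaryPoint g (4 * (i : ℕ) + (s : ℝ)))
  continuous_toFun :=
    continuous_quot_mk.comp ((continuous_boundaryPoint g).comp (by fun_prop))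

/-- The standard generator `bᵢ`: the image in the surface of the `4 * i + 1`-st side. -/
def loopB (g : ℕ) (i : Fin g) : C(I, StandardSurface g) where
  toFun s := Quot.mk _ (boundaryPoint g (4 * (i : ℕ) + 1 + (s : ℝ)))
  continuous_toFun :=
    continuous_quot_mk.comp ((continuous_boundaryPoint g).comp (by fun_prop))

/-- The group of deck transformations of `p : E → S` under composition. -/
def deckGroup {E S : Type*} [TopologicalSpace E] (p : E → S) : Subgroup (E ≃ₜ E) where
  carrier := {d | ∀ e, p (d e) = p e}
  one_mem' _ := rfl
  mul_mem' {d d'} hd hd' e := (hd (d' e)).trans (hd' e)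
  inv_mem' {d} hd e := by
    have h := hd (d⁻¹ e)
    rw [← h]
    exact congrArg p (d.apply_symm_apply e)

/-- A (connected) regular covering space of `S`: the deck transformation group acts transitively
on every fibre. -/
structure RegularCover (S : Type u) [TopologicalSpace S] where
  /-- The total space. -/
  E : Type u
  [top : TopologicalSpace E]
  [pathConnected : PathConnectedSpace E]
  /-- The covering projection. -/
  p : C(E, S)
  surjective : Function.Surjective p
  isCovering : IsCoveringMap p
  regular : ∀ e e' : E, p e = p e' → ∃ d ∈ deckGroup p, d e = e'

attribute [instance] RegularCover.top RegularCover.pathConnected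

/-- The deck transformation group of a regular cover. -/
abbrev RegularCover.Deck {S : Type u} [TopologicalSpace S] (C : RegularCover S) : Type u :=
  deckGroup C.p

/-- The deck transformation `d` is the one that the loop `γ` in `S` determines with respect to the
base point `e₀` of the cover: the lift of `γ` that starts at `e₀` ends at `d e₀`. -/
def RegularCover.DeckOfLoop {S : Type u} [TopologicalSpace S] (C : RegularCover S)
    (e₀ : C.E) (γ : C(I, S)) (d : C.Deck) : Prop :=
  ∃ Γ : C(I, C.E), (∀ t, C.p (Γ t) = γ t) ∧ Γ 0 = e₀ ∧ Γ 1 = (d : C.E ≃ₜ C.E) e₀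

end

/-! ### Generating sets and differences of powers of two. -/

section

open RegularWreathProduct commutatorElement

/-! Sending `aᵢ` to `xᵢ` and `bᵢ` to `1` respects the surface relation, so every group generated by
`g` elements should be a deck group. As `g ≥ 2`, the embedding claims reduce to embedding `G` in a
group generated by the image of `x` and one further element (`exists_two_generator_overgroup`).

That embedding has two stages. In `exists_isPerfect_overgroup`, `G` acts on a free module so that
each `g` is a commutator with a shift and `x - 1` divides `1` from both sides. The elementary 3×3
matrices over a finitely generated ring of endomorphisms then form a finitely generated perfect
group, which contains `G` as `diag(g, 1, 1)` and is the normal closure of `x`. In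
`exists_two_generator_overgroup_of_isPerfect`, such a group `H` is generated by finitely many
conjugates of `x`. Place twisted copies of `H` at the positions `2 ^ j` of a wreath product with
`ℤ`. Commutators of translates of `x` are concentrated at a single position, and perfectness
recovers all of `H` there.

The cover is built without computing `π₁(S)` (`exists_regularCover_of_generators`). For each `i`, a
band in the polygon joins the two copies of `aᵢ`; it defines a map from `S` to the circle that winds
once along `aᵢ` and is constant on `bᵢ`. The bands do not overlap, so right multiplication by `xᵢ`
on crossing band `i` is a cocycle. Left multiplication on the resulting bundle supplies all deck
transformations.

The description of `D` as a quotient of `π₁(S)` holds because deck transformations act freely, by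
uniqueness of lifts, and transitively on fibres. -/

theorem Subgroup.exists_finite_subset_mem_closure {G : Type*} [Group G] {T : Set G} {x : G}
    (hx : x ∈ Subgroup.closure T) : ∃ T' ⊆ T, T'.Finite ∧ x ∈ Subgroup.closure T' := by
  induction hx using Subgroup.closure_induction with
  | mem x hx => exact ⟨{x}, by simpa using hx, Set.finite_singleton x,
      Subgroup.subset_closure rfl⟩
  | one => exact ⟨∅, by simp, Set.finite_empty, one_mem _⟩
  | mul x y _ _ hx hy =>
    obtain ⟨A, hA, fA, hxA⟩ := hx
    obtain ⟨B, hB, fB, hyB⟩ := hy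
    exact ⟨A ∪ B, Set.union_subset hA hB, fA.union fB,
      mul_mem (Subgroup.closure_mono Set.subset_union_left hxA)
        (Subgroup.closure_mono Set.subset_union_right hyB)⟩
  | inv x _ hx =>
    obtain ⟨A, hA, fA, hxA⟩ := hx
    exact ⟨A, hA, fA, inv_mem hxA⟩

theorem Group.FG.exists_finite_subset_closure_eq_top {G : Type*} [Group G] [Group.FG G]
    {T : Set G} (hT : Subgroup.closure T = ⊤) :
    ∃ T' ⊆ T, T'.Finite ∧ Subgroup.closure T' = ⊤ := by
  obtain ⟨S, hS, fS⟩ := Group.fg_iff.1 (inferInstance : Group.FG G)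
  have h (s : G) : ∃ T' ⊆ T, T'.Finite ∧ s ∈ Subgroup.closure T' :=
    Subgroup.exists_finite_subset_mem_closure (hT ▸ Subgroup.mem_top s)
  choose A hA fA hsA using h
  refine ⟨⋃ s ∈ S, A s, Set.iUnion₂_subset fun s _ => hA s, fS.biUnion fun s _ => fA s, ?_⟩
  rw [eq_top_iff, ← hS, Subgroup.closure_le]
  exact fun s hs => Subgroup.closure_mono (Set.subset_biUnion_of_mem hs) (hsA s)

theorem two_pow_add_two_pow_le {a b i j : ℕ} (h : 2 ^ a + 2 ^ b = 2 ^ i + 2 ^ j) (hij : i ≤ j) :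
    a ≤ j := by
  by_contra! hlt
  have h1 : 2 ^ (j + 1) ≤ 2 ^ a := Nat.pow_le_pow_right two_pos hlt
  have h2 : 2 ^ i ≤ 2 ^ j := Nat.pow_le_pow_right two_pos hij
  have h3 := Nat.two_pow_pos b
  rw [pow_succ] at h1
  omega

/-- Differences of distinct powers of two determine the powers. -/
theorem two_pow_sub_two_pow_inj {a b i j : ℕ} (hij : i ≠ j)
    (h : (2 : ℤ) ^ a - 2 ^ b = 2 ^ i - 2 ^ j) : a = i := by
  have inj {m n : ℕ} (h : 2 ^ m = 2 ^ n) : m = n := Nat.pow_right_injective le_rfl h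
  have key : 2 ^ a + 2 ^ j = 2 ^ i + 2 ^ b := by zify; linarith
  have key' : 2 ^ j + 2 ^ a = 2 ^ i + 2 ^ b := by omega
  by_contra hai
  -- The larger exponents on the two sides of `key` agree; cancelling them leaves `a = i` or `i =
  -- j`.
  rcases le_total i b with hib | hib <;> rcases le_total a j with haj | haj
  · have h1 : j = b := le_antisymm (two_pow_add_two_pow_le key' hib)
      (two_pow_add_two_pow_le (b := i) (i := a) (by omega) haj)
    subst h1; exact hai (inj (by omega))
  · have h1 : a = b := le_antisymm (two_pow_add_two_pow_le key hib)
      (two_pow_add_two_pow_le (b := i) (i := j) (by omega) haj)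
    subst h1; exact hij (inj (by omega))
  · have h1 : j = i := le_antisymm (two_pow_add_two_pow_le (b := a) (i := b) (by omega) hib)
      (two_pow_add_two_pow_le (b := b) (i := a) (by omega) haj)
    exact hij h1.symm
  · exact hai (le_antisymm (two_pow_add_two_pow_le (b := j) (i := b) (by omega) hib)
      (two_pow_add_two_pow_le (b := b) (i := j) (by omega) haj))

/-! ### Wreath products and the two-generator embedding of a perfect group. -/

namespace RegularWreathProduct

variable {D Q : Type*} [Group D] [Group Q]

/-- The base group of a wreath product. -/
def base : (Q → D) →* D ≀ᵣ Q where
  toFun f := ⟨f, 1⟩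
  map_one' := rfl
  map_mul' f f' := by ext <;> simp

theorem base_injective : Function.Injective (base : (Q → D) →* D ≀ᵣ Q) :=
  fun _ _ h => congrArg left h

theorem inl_mul_base_mul_inl_inv (q : Q) (f : Q → D) :
    inl q * base f * (inl q)⁻¹ = base fun y => f (q⁻¹ * y) := by
  ext <;> simp [base]

end RegularWreathProduct


/-- If all commutators of a generating set lie in a subgroup that is normalized by that set, then
the subgroup contains the derived subgroup. -/
theorem Subgroup.commutator_le_of_closure_eq_top {H ι : Type*} [Group H] {a : ι → H}
    (ha : Subgroup.closure (Set.range a) = ⊤) {L : Subgroup H}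
    (hc : ∀ i j, ⁅a i, a j⁆ ∈ L) (hn : ∀ i h, a i * h * (a i)⁻¹ ∈ L ↔ h ∈ L) :
    _root_.commutator H ≤ L := by
  have hL : L.Normal := by
    rw [← Subgroup.normalizer_eq_top_iff, eq_top_iff, ← ha, Subgroup.closure_le]
    rintro _ ⟨i, rfl⟩
    exact Subgroup.mem_normalizer_iff.2 fun h => (hn i h).symm
  have hcl : Subgroup.closure (Set.range fun i => (a i : H ⧸ L)) = ⊤ := by
    have := congrArg (Subgroup.map (QuotientGroup.mk' L)) ha
    rw [MonoidHom.map_closure, ← Set.range_comp,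
      Subgroup.map_top_of_surjective _ (QuotientGroup.mk'_surjective L)] at this
    exact this
  -- The images of the `a i` generate the quotient and commute pairwise, so the quotient is abelian.
  have hcomm : ∀ x y : H ⧸ L, x * y = y * x := by
    have h1 : ∀ i, ∀ y : H ⧸ L, (a i : H ⧸ L) * y = y * (a i : H ⧸ L) := by
      intro i y
      have : (⊤ : Subgroup (H ⧸ L)) ≤ Subgroup.centralizer {(a i : H ⧸ L)} := by
        rw [← hcl, Subgroup.closure_le]
        rintro _ ⟨j, rfl⟩
        rw [SetLike.mem_coe, Subgroup.mem_centralizer_singleton_iff,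
          ← commutatorElement_eq_one_iff_mul_comm]
        exact (QuotientGroup.eq_one_iff _).2 (hc _ _)
      exact (Subgroup.mem_centralizer_singleton_iff.1 (this (Subgroup.mem_top y))).symm
    intro x y
    have : (⊤ : Subgroup (H ⧸ L)) ≤ Subgroup.centralizer {y} := by
      rw [← hcl, Subgroup.closure_le]
      rintro _ ⟨j, rfl⟩
      exact Subgroup.mem_centralizer_singleton_iff.2 (h1 j y)
    exact Subgroup.mem_centralizer_singleton_iff.1 (this (Subgroup.mem_top x))
  rw [_root_.commutator, Subgroup.commutator_le]
  intro x _ y _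
  rw [← QuotientGroup.eq_one_iff]
  exact commutatorElement_eq_one_iff_mul_comm.2 (hcomm (x : H ⧸ L) y)

/-- A finitely generated perfect group that is normally generated by `x` embeds in a group
generated by the image of `x` and one further element. -/
theorem exists_two_generator_overgroup_of_isPerfect {H : Type v} [Group H] [Group.FG H]
    [Group.IsPerfect H] (x : H) (hx : Subgroup.normalClosure {x} = ⊤) :
    ∃ (W : Type v) (_ : Group W) (ι : H →* W) (t : W), Function.Injective ι ∧
      ι.range ≤ Subgroup.closure {ι x, t} := by
  classical
  obtain ⟨T, hTs, fT, hT⟩ := Group.FG.exists_finite_subset_closure_eq_top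
    (T := Group.conjugatesOfSet {x}) hx
  -- The trivial group is split off so that there is at least one position `q j`, at which
  -- injectivity of `ι` can be read off.
  by_cases hsub : Subsingleton H
  · refine ⟨H, inferInstance, MonoidHom.id H, 1, Function.injective_id, ?_⟩
    rintro y -
    rw [Subsingleton.elim y 1]
    exact one_mem _
  obtain ⟨n, a, rfl⟩ : ∃ (n : ℕ) (a : Fin n → H), Set.range a = T :=
    let ⟨n, a, ha⟩ := fT.fin_embedding
    ⟨n, a, ha⟩
  have hac : ∀ i, ∃ c, c * x * c⁻¹ = a i := fun i => by
    have := hTs ⟨i, rfl⟩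
    rw [Group.mem_conjugatesOfSet_iff] at this
    simpa [isConj_iff] using this
  choose c hc using hac
  -- By `hq2`, the supports of two different translates of `F x`, each moved so that one of its
  -- positions comes to `1`, meet only at `1`.
  let q : Fin n → Multiplicative ℤ := fun i => Multiplicative.ofAdd (2 ^ (i : ℕ))
  have hq : Function.Injective q := fun i j h => by
    have : (2 : ℤ) ^ (i : ℕ) = 2 ^ (j : ℕ) := Multiplicative.ofAdd.injective h
    exact Fin.ext (Int.pow_right_injective (by norm_num) this)
  have hq2 {k l i j : Fin n} (hij : i ≠ j) (h : q k * (q l)⁻¹ = q i * (q j)⁻¹) : k = i := by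
    refine Fin.ext (two_pow_sub_two_pow_inj (b := l) (j := j) (fun h => hij (Fin.ext h)) ?_)
    have := congrArg Multiplicative.toAdd h
    simpa [q, sub_eq_add_neg] using this
  let F : H →* (Multiplicative ℤ → H) :=
    -- Conjugating by `c j` makes the coordinate of `F x` at `q j` equal to the generator `a j`.
    { toFun := fun h y => if hy : ∃ j, q j = y then c hy.choose * h * (c hy.choose)⁻¹ else 1
      map_one' := by ext y; split_ifs <;> simp
      map_mul' := by intro h h'; ext y; simp only [Pi.mul_apply]; split_ifs <;> simp }
  have hFq (h : H) (j : Fin n) : F h (q j) = c j * h * (c j)⁻¹ := by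
    have hy : ∃ k, q k = q j := ⟨j, rfl⟩
    have : hy.choose = j := hq hy.choose_spec
    simp only [F, MonoidHom.coe_mk, OneHom.coe_mk, dif_pos hy, this]
  have hF1 (h : H) (y) (hy : ¬ ∃ j, q j = y) : F h y = 1 := by
    simp only [F, MonoidHom.coe_mk, OneHom.coe_mk, dif_neg hy]
  let ι : H →* H ≀ᵣ Multiplicative ℤ := base.comp F
  let t : H ≀ᵣ Multiplicative ℤ := inl (Multiplicative.ofAdd 1)
  have hn : Nonempty (Fin n) := by
    by_contra hn
    rw [not_nonempty_iff] at hn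
    rw [Set.range_eq_empty, Subgroup.closure_empty] at hT
    exact hsub (Subgroup.subsingleton_iff.1 (subsingleton_of_bot_eq_top hT))
  refine ⟨_, inferInstance, ι, t, ?_, ?_⟩
  · refine base_injective.comp fun h h' hh => ?_
    have := congrFun hh (q hn.some)
    simpa [hFq] using this
  set K := Subgroup.closure {ι x, t} with hK
  have hιx : ι x ∈ K := Subgroup.subset_closure (by simp)
  have htq (y : Multiplicative ℤ) : inl y ∈ K := by
    have : (inl y : H ≀ᵣ Multiplicative ℤ) = t ^ (Multiplicative.toAdd y) := by
      rw [← map_zpow]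
      congr 1
      apply Multiplicative.toAdd.injective
      simp
    rw [this]
    exact zpow_mem (Subgroup.subset_closure (by simp)) _
  let L : Subgroup H := K.comap (base.comp (MonoidHom.mulSingle (fun _ => H) 1))
  have hL (h : H) : h ∈ L ↔ base (Pi.mulSingle 1 h) ∈ K := Iff.rfl
  have hY (i : Fin n) : base (fun y => F x (q i * y)) ∈ K := by
    have := inl_mul_base_mul_inl_inv (q i)⁻¹ (F x)
    rw [inv_inv] at this
    rw [← this]
    exact mul_mem (mul_mem (htq _) hιx) (inv_mem (htq _))
  have hLtop : L = ⊤ := by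
    rw [eq_top_iff, ← Group.IsPerfect.commutator_eq_top]
    refine Subgroup.commutator_le_of_closure_eq_top hT ?_ ?_
    · intro i j
      by_cases hij : i = j
      · subst hij; rw [commutatorElement_self]; exact one_mem _
      have : base (Pi.mulSingle 1 ⁅a i, a j⁆) =
          ⁅base (fun y => F x (q i * y)), base (fun y => F x (q j * y))⁆ := by
        rw [← map_commutatorElement]
        congr 1
        ext y
        rw [show ⁅(fun y => F x (q i * y)), (fun y => F x (q j * y))⁆ y =
          ⁅F x (q i * y), F x (q j * y)⁆ from rfl]
        by_cases hy : y = 1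
        · subst hy; simp [hFq, hc]
        rw [Pi.mulSingle_eq_of_ne hy]
        by_cases h1 : ∃ k, q k = q i * y
        · by_cases h2 : ∃ k, q k = q j * y
          · obtain ⟨k, hk⟩ := h1
            obtain ⟨l, hl⟩ := h2
            -- If both translates are supported at `y`, then `q k * (q l)⁻¹ = q i * (q j)⁻¹`, which
            -- forces `y = 1`.
            have : k = i := hq2 (l := l) hij (by rw [hk, hl, mul_inv_rev]; group)
            subst this
            exact absurd (by simpa using hk) hy
          · rw [hF1 _ _ h2, commutatorElement_one_right]
        · rw [hF1 _ _ h1, commutatorElement_one_left]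
      rw [hL, this]
      exact Subgroup.commutator_le_self K (Subgroup.commutator_mem_commutator (hY i) (hY j))
    · intro i h
      -- Conjugation by the translate acts on the coordinate at `1` as conjugation by `a i`; at the
      -- other coordinates there is nothing to conjugate.
      have : base (Pi.mulSingle 1 (a i * h * (a i)⁻¹)) = base (fun y => F x (q i * y)) *
          base (Pi.mulSingle 1 h) * (base (fun y => F x (q i * y)))⁻¹ := by
        rw [← map_mul, ← map_inv, ← map_mul]
        congr 1
        ext y
        by_cases hy : y = 1
        · subst hy; simp [hFq, hc]
        · simp [hy]
      rw [hL, hL, this, Subgroup.mul_mem_cancel_right _ (inv_mem (hY i)),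
        Subgroup.mul_mem_cancel_left _ (hY i)]
  have hsingle (y : Multiplicative ℤ) (h : H) : base (Pi.mulSingle y h) ∈ K := by
    have h1 : base (Pi.mulSingle 1 h) ∈ K := by rw [← hL, hLtop]; exact Subgroup.mem_top h
    have : base (Pi.mulSingle y h) = inl y * base (Pi.mulSingle 1 h) * (inl y)⁻¹ := by
      rw [inl_mul_base_mul_inl_inv]
      congr 1
      ext z
      by_cases hz : z = y
      · subst hz; simp
      · rw [Pi.mulSingle_eq_of_ne hz, Pi.mulSingle_eq_of_ne]
        simpa [inv_mul_eq_one, eq_comm] using hz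
    rw [this]
    exact mul_mem (mul_mem (htq _) h1) (inv_mem (htq _))
  have hfin (A : Finset (Multiplicative ℤ)) : ∀ f : Multiplicative ℤ → H,
      (∀ y ∉ A, f y = 1) → base f ∈ K := by
    induction A using Finset.induction_on with
    | empty =>
      intro f hf
      have : f = 1 := funext fun y => hf y (by simp)
      rw [this, map_one]; exact one_mem _
    | insert b A _ ih =>
      intro f hf
      have : f = Function.update f b 1 * Pi.mulSingle b (f b) := by
        ext y
        by_cases hy : y = b
        · subst hy; simp
        · simp [hy]
      rw [this, map_mul]
      refine mul_mem (ih _ fun y hy => ?_) (hsingle _ _)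
      by_cases hyb : y = b
      · subst hyb; simp
      · simp [hyb, hf y (by simp [hyb, hy])]
  rintro _ ⟨h, rfl⟩
  refine hfin (Finset.univ.image q) _ fun y hy => hF1 _ _ ?_
  simpa using hy

/-! ### Elementary matrices over a noncommutative ring. -/

namespace Matrix

section Elementary

variable {n A : Type*} [Fintype n] [DecidableEq n] [Ring A]

/-- The elementary matrix with entry `r` in position `(i, j)`, as a unit. The ring of
coefficients need not be commutative. -/
def elementary {i j : n} (h : i ≠ j) (r : A) : (Matrix n n A)ˣ where
  val := 1 + single i j r
  inv := 1 - single i j r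
  val_inv := by
    simp [mul_sub, add_mul, single_mul_single_of_ne _ _ _ _ h.symm]
  inv_val := by
    simp [mul_add, sub_mul, single_mul_single_of_ne _ _ _ _ h.symm]

theorem elementary_zero {i j : n} (h : i ≠ j) : elementary h (0 : A) = 1 := by
  ext1; simp [elementary]

theorem elementary_add {i j : n} (h : i ≠ j) (r s : A) :
    elementary h (r + s) = elementary h r * elementary h s := by
  ext1
  simp [elementary, mul_add, add_mul, single_mul_single_of_ne _ _ _ _ h.symm, single_add,
    add_assoc]

theorem elementary_neg {i j : n} (h : i ≠ j) (r : A) :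
    elementary h (-r) = (elementary h r)⁻¹ := by
  rw [eq_inv_iff_mul_eq_one, ← elementary_add, neg_add_cancel, elementary_zero]

theorem commutator_elementary {i j k : n} (hij : i ≠ j) (hik : i ≠ k) (hkj : k ≠ j) (r s : A) :
    ⁅elementary hik r, elementary hkj s⁆ = elementary hij (r * s) := by
  rw [commutatorElement_def, mul_inv_eq_iff_eq_mul, mul_inv_eq_iff_eq_mul]
  ext1
  simp [elementary, mul_add, add_mul, single_mul_single_of_ne _ _ _ _ hkj.symm,
    single_mul_single_of_ne _ _ _ _ hij.symm]
  abel

/-- The diagonal matrix with given invertible entries, as a unit. -/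
def diagonalUnits : (n → Aˣ) →* (Matrix n n A)ˣ :=
  (Units.map (diagonalRingHom n A : (n → A) →* Matrix n n A)).comp
    MulEquiv.piUnits.symm.toMonoidHom

theorem coe_diagonalUnits (d : n → Aˣ) :
    (diagonalUnits d : Matrix n n A) = diagonal fun i => (d i : A) := rfl

theorem diagonalUnits_injective :
    Function.Injective (diagonalUnits : (n → Aˣ) →* (Matrix n n A)ˣ) := by
  intro d d' h
  have h1 := congrArg (Units.val) h
  rw [coe_diagonalUnits, coe_diagonalUnits, diagonal_eq_diagonal_iff] at h1
  exact funext fun i => Units.ext (h1 i)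

theorem diagonalUnits_conj_elementary (d : n → Aˣ) {i j : n} (h : i ≠ j) (r : A) :
    diagonalUnits d * elementary h r * (diagonalUnits d)⁻¹ =
      elementary h (d i * r * (d j)⁻¹) := by
  rw [mul_inv_eq_iff_eq_mul]
  ext1
  simp only [elementary, Units.val_mul, coe_diagonalUnits, mul_add, add_mul, mul_one, one_mul,
    add_right_inj]
  ext a b
  rw [diagonal_mul, mul_diagonal]
  by_cases hab : i = a ∧ j = b
  · obtain ⟨rfl, rfl⟩ := hab
    simp
  · simp [single_apply_of_ne _ _ _ _ _ hab]

/-- The subgroup generated by the elementary matrices with entries in `R`. -/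
def elementarySubgroup (n : Type*) [Fintype n] [DecidableEq n] (R : Subring A) :
    Subgroup (Matrix n n A)ˣ :=
  Subgroup.closure {M | ∃ (i j : n) (h : i ≠ j), ∃ r ∈ R, M = elementary h r}

theorem elementary_mem {R : Subring A} {i j : n} (h : i ≠ j) {r : A} (hr : r ∈ R) :
    elementary h r ∈ elementarySubgroup n R :=
  Subgroup.subset_closure ⟨i, j, h, r, hr, rfl⟩

end Elementary

section Three

variable {A : Type*} [Ring A]

theorem exists_third (i j : Fin 3) : ∃ k, i ≠ k ∧ k ≠ j := by
  revert i j; decide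

/-- A third index turns products of entries into commutators, and sums of entries are products of
matrices. So entries from `S` together with `1` suffice. -/
theorem elementarySubgroup_fg {S : Set A} (hS : S.Finite) :
    (elementarySubgroup (Fin 3) (Subring.closure S)).FG := by
  rw [Subgroup.fg_iff]
  let T : Set (Matrix (Fin 3) (Fin 3) A)ˣ :=
    ⋃ p : {p : Fin 3 × Fin 3 // p.1 ≠ p.2}, (fun r => elementary p.2 r) '' (insert 1 S)
  refine ⟨T, le_antisymm ?_ ?_, Set.finite_iUnion fun p => (hS.insert 1).image _⟩
  · rw [Subgroup.closure_le]
    intro M hM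
    obtain ⟨⟨⟨i, j⟩, h⟩, r, hr, rfl⟩ := Set.mem_iUnion.1 hM
    refine elementary_mem h ?_
    rcases hr with rfl | hr
    · exact one_mem _
    · exact Subring.subset_closure hr
  · refine (Subgroup.closure_le _).2 ?_
    rintro _ ⟨i, j, h, r, hr, rfl⟩
    have hT {i j : Fin 3} (h : i ≠ j) {r : A} (hr : r ∈ insert 1 S) :
        elementary h r ∈ Subgroup.closure T :=
      Subgroup.subset_closure (Set.mem_iUnion.2 ⟨⟨(i, j), h⟩, r, hr, rfl⟩)
    rw [SetLike.mem_coe]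
    induction hr using Subring.closure_induction generalizing i j with
    | mem r hr => exact hT h (Or.inr hr)
    | zero => rw [elementary_zero]; exact one_mem _
    | one => exact hT h (Or.inl rfl)
    | add r s _ _ hr hs => rw [elementary_add]; exact mul_mem (hr i j h) (hs i j h)
    | neg r _ hr => rw [elementary_neg]; exact inv_mem (hr i j h)
    | mul r s _ _ hr hs =>
      obtain ⟨k, hik, hkj⟩ := exists_third i j
      rw [← commutator_elementary h hik hkj]
      exact Subgroup.commutator_le_self _
        (Subgroup.commutator_mem_commutator (hr i k hik) (hs k j hkj))

theorem elementarySubgroup_isPerfect (R : Subring A) :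
    Group.IsPerfect (elementarySubgroup (Fin 3) R) := by
  rw [Subgroup.isPerfect_iff]
  refine le_antisymm (Subgroup.commutator_le_self _) ((Subgroup.closure_le _).2 ?_)
  rintro _ ⟨i, j, h, r, hr, rfl⟩
  obtain ⟨k, hik, hkj⟩ := exists_third i j
  rw [← mul_one r, ← commutator_elementary h hik hkj]
  exact Subgroup.commutator_mem_commutator (elementary_mem _ hr) (elementary_mem _ (one_mem R))

/-- Whitehead's lemma. -/
theorem diagonalUnits_mulSingle_mul_mulSingle_inv_mem {R : Subring A} {j : Fin 3} (h : 0 ≠ j)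
    {f : Aˣ} (hf : (f : A) ∈ R) (hf' : ((f⁻¹ : Aˣ) : A) ∈ R) :
    diagonalUnits (Pi.mulSingle 0 f * Pi.mulSingle j f⁻¹) ∈ elementarySubgroup (Fin 3) R := by
  -- With `w(f) = e(f) e'(-f⁻¹) e(f)`, where `e'` is the transposed position, this is `w(f) w(-1)`.
  have key : diagonalUnits (Pi.mulSingle 0 f * Pi.mulSingle j f⁻¹) =
      elementary h (f : A) * elementary h.symm (-(f⁻¹ : Aˣ) : A) * elementary h (f : A) *
      (elementary h (-1) * elementary h.symm 1 * elementary h (-1)) := by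
    ext1
    fin_cases j
    · exact absurd rfl h
    all_goals
      ext a b
      fin_cases a <;> fin_cases b <;>
      simp [coe_diagonalUnits, elementary, Matrix.mul_apply, Fin.sum_univ_three,
        Matrix.single, Matrix.one_apply]
  rw [key]
  have h1 := one_mem R
  exact mul_mem (mul_mem (mul_mem (elementary_mem _ hf) (elementary_mem _ (neg_mem hf')))
    (elementary_mem _ hf)) (mul_mem (mul_mem (elementary_mem _ (neg_mem h1))
    (elementary_mem _ h1)) (elementary_mem _ (neg_mem h1)))

/-- The matrix `diag(u, 1, 1)`. -/
def cornerUnits : Aˣ →* (Matrix (Fin 3) (Fin 3) A)ˣ :=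
  diagonalUnits.comp (MonoidHom.mulSingle (fun _ => Aˣ) 0)

theorem cornerUnits_apply (u : Aˣ) :
    (cornerUnits u : (Matrix (Fin 3) (Fin 3) A)ˣ) = diagonalUnits (Pi.mulSingle 0 u) := rfl

theorem cornerUnits_injective :
    Function.Injective (cornerUnits : Aˣ →* (Matrix (Fin 3) (Fin 3) A)ˣ) :=
  fun _ _ h => Pi.mulSingle_injective 0 (diagonalUnits_injective h)

/-- Take the commutator of `diag(f, f⁻¹, 1)` and `diag(g, 1, g⁻¹)`: the compensating inverses sit in
different slots, so only the corner survives. -/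
theorem cornerUnits_commutator_mem {R : Subring A} {f g : Aˣ}
    (hf : (f : A) ∈ R) (hf' : ((f⁻¹ : Aˣ) : A) ∈ R) (hg : (g : A) ∈ R)
    (hg' : ((g⁻¹ : Aˣ) : A) ∈ R) :
    cornerUnits ⁅f, g⁆ ∈ elementarySubgroup (Fin 3) R := by
  have h : (Pi.mulSingle 0 ⁅f, g⁆ : Fin 3 → Aˣ) =
      ⁅(Pi.mulSingle 0 f * Pi.mulSingle 1 f⁻¹ : Fin 3 → Aˣ),
        (Pi.mulSingle 0 g * Pi.mulSingle 2 g⁻¹ : Fin 3 → Aˣ)⁆ := by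
    ext1 a
    rw [commutatorElement_def, commutatorElement_def]
    fin_cases a <;> simp
  rw [cornerUnits_apply, h, map_commutatorElement]
  exact Subgroup.commutator_le_self _ (Subgroup.commutator_mem_commutator
    (diagonalUnits_mulSingle_mul_mulSingle_inv_mem (by decide) hf hf')
    (diagonalUnits_mulSingle_mul_mulSingle_inv_mem (by decide) hg hg'))

/-- If `u - 1` generates the unit ideal in the strong sense that `p * (u - 1) * q = 1`, then every
subgroup containing `diag(u, 1, 1)` that is normalized by the elementary matrices contains them
all. -/
theorem elementarySubgroup_le_of_cornerUnits_mem {R : Subring A} {u : Aˣ} {p q : A}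
    (hp : p ∈ R) (hq : q ∈ R) (hpq : p * (u - 1) * q = 1)
    {N : Subgroup (Matrix (Fin 3) (Fin 3) A)ˣ}
    (hN : ∀ e ∈ elementarySubgroup (Fin 3) R, ∀ m ∈ N, e * m * e⁻¹ ∈ N)
    (hu : cornerUnits u ∈ N) : elementarySubgroup (Fin 3) R ≤ N := by
  have left {e m} (he : e ∈ elementarySubgroup (Fin 3) R) (hm : m ∈ N) : ⁅e, m⁆ ∈ N :=
    mul_mem (hN e he m hm) (inv_mem hm)
  have right {e m} (he : e ∈ elementarySubgroup (Fin 3) R) (hm : m ∈ N) : ⁅m, e⁆ ∈ N := by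
    rw [← commutatorElement_inv]; exact inv_mem (left he hm)
  have h1 := one_mem R
  have col {i j k : Fin 3} (hij : i ≠ j) (hik : i ≠ k) (hkj : k ≠ j) {r : A} (hr : r ∈ R)
      (h : elementary hik (1 : A) ∈ N) : elementary hij r ∈ N := by
    rw [← one_mul r, ← commutator_elementary hij hik hkj]
    exact right (elementary_mem _ hr) h
  have row {i j k : Fin 3} (hij : i ≠ j) (hik : i ≠ k) (hkj : k ≠ j)
      (h : elementary hkj (1 : A) ∈ N) : elementary hij (1 : A) ∈ N := by
    rw [← one_mul (1 : A), ← commutator_elementary hij hik hkj]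
    exact left (elementary_mem _ h1) h
  have h01 : (0 : Fin 3) ≠ 1 := by decide
  have h02 : (0 : Fin 3) ≠ 2 := by decide
  have h12 : (1 : Fin 3) ≠ 2 := by decide
  -- A commutator with `q` on the right, then one with `p` on the left, produces the entry `p * (u -
  -- 1) * q = 1`. From there `col` and `row` reach all six positions.
  have ha : elementary h01 ((u - 1) * q) ∈ N := by
    have : elementary h01 ((u - 1) * q) = ⁅cornerUnits u, elementary h01 q⁆ := by
      rw [cornerUnits_apply, commutatorElement_def, diagonalUnits_conj_elementary, ← elementary_neg,
        ← elementary_add]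
      congr 1
      simp [sub_eq_add_neg, add_mul]
    rw [this]
    exact right (elementary_mem _ hq) hu
  have e21 : elementary h12.symm (1 : A) ∈ N := by
    rw [← hpq, mul_assoc, ← commutator_elementary h12.symm h02.symm h01]
    exact left (elementary_mem _ hp) ha
  have e20 : elementary h02.symm (1 : A) ∈ N := col _ _ h01.symm h1 e21
  have e10 : elementary h01.symm (1 : A) ∈ N := row _ h12 _ e20
  have e12 : elementary h12 (1 : A) ∈ N := col _ _ h02 h1 e10
  have e02 : elementary h02 (1 : A) ∈ N := row _ h01 _ e12
  have e01 : elementary h01 (1 : A) ∈ N := col _ _ h12.symm h1 e02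
  refine (Subgroup.closure_le _).2 ?_
  rintro _ ⟨i, j, h, r, hr, rfl⟩
  obtain ⟨k, hik, hkj⟩ := exists_third i j
  refine col h hik hkj hr ?_
  fin_cases i <;> fin_cases k <;> first | exact absurd rfl hik | assumption

end Three

end Matrix

/-! ### Embedding in a finitely generated perfect group. -/

/-- A group of units of a ring `A` embeds in a finitely generated perfect group that is normally
generated by `x`, provided that its elements are suitable commutators of units and that `x - 1` is
a divisor of `1`. -/
theorem exists_isPerfect_overgroup_of_units {G : Type*} {A : Type v} [Group G] [Ring A]
    {S : Set A} (hS : S.Finite) (f : G →* Aˣ) (s : Aˣ) (j : G →* Aˣ) (hj : Function.Injective j)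
    (hjf : ∀ g, j g = ⁅f g, s⁆) (hf : ∀ g, (f g : A) ∈ Subring.closure S)
    (hs : (s : A) ∈ Subring.closure S) (hs' : ((s⁻¹ : Aˣ) : A) ∈ Subring.closure S) (x : G)
    {p q : A} (hp : p ∈ Subring.closure S) (hq : q ∈ Subring.closure S)
    (hpq : p * (j x - 1) * q = 1) :
    ∃ (H : Type v) (_ : Group H) (_ : Group.FG H) (_ : Group.IsPerfect H) (φ : G →* H),
      Function.Injective φ ∧ Subgroup.normalClosure {φ x} = ⊤ := by
  let R := Subring.closure S
  let E := Matrix.elementarySubgroup (Fin 3) R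
  have hmem (g : G) : Matrix.cornerUnits (j g) ∈ E := by
    rw [hjf]
    refine Matrix.cornerUnits_commutator_mem (hf g) ?_ hs hs'
    rw [← map_inv]
    exact hf _
  let φ : G →* E := (Matrix.cornerUnits.comp j).codRestrict E hmem
  refine ⟨E, inferInstance, (Group.fg_iff_subgroup_fg _).2 (Matrix.elementarySubgroup_fg hS),
    Matrix.elementarySubgroup_isPerfect R, φ, ?_, ?_⟩
  · intro g g' h
    exact hj (Matrix.cornerUnits_injective (congrArg Subtype.val h))
  · have hle : E ≤ (Subgroup.normalClosure {φ x}).map E.subtype := by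
      refine Matrix.elementarySubgroup_le_of_cornerUnits_mem hp hq hpq ?_ ?_
      · intro e he m hm
        obtain ⟨m, hm', rfl⟩ := Subgroup.mem_map.1 hm
        exact Subgroup.mem_map.2 ⟨_, Subgroup.normalClosure_normal.conj_mem m hm' ⟨e, he⟩, rfl⟩
      · exact Subgroup.mem_map.2 ⟨φ x, Subgroup.subset_normalClosure rfl, rfl⟩
    rw [eq_top_iff]
    intro e _
    obtain ⟨e', he', h⟩ := Subgroup.mem_map.1 (hle e.2)
    rwa [← Subtype.ext h]

theorem Group.FG.countable (G : Type*) [Group G] [h : Group.FG G] : Countable G := by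
  obtain ⟨α, _, φ, hφ⟩ := Group.fg_iff_exists_freeGroup_hom_surjective_finite.1 h
  exact hφ.countable

/-- Left multiplication by elements of `G` on those levels of `G × ℕ × ℤ` that satisfy `P`. -/
def levelMul (G : Type*) [Group G] (P : ℤ → Prop) [DecidablePred P] :
    G →* Equiv.Perm (G × ℕ × ℤ) :=
  MonoidHom.toHomPerm
    { toFun := fun g y => (if P y.2.2 then g * y.1 else y.1, y.2)
      map_one' := by funext y; simp; rfl
      map_mul' := by
        intro g h; funext y
        change _ = (if P y.2.2 then g * (if P y.2.2 then h * y.1 else y.1) else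
          (if P y.2.2 then h * y.1 else y.1), y.2)
        split_ifs <;> simp [mul_assoc] }

theorem levelMul_apply {G : Type*} [Group G] (P : ℤ → Prop) [DecidablePred P] (g : G)
    (y : G × ℕ × ℤ) : levelMul G P g y = (if P y.2.2 then g * y.1 else y.1, y.2) := rfl

/-- The shift of the levels of `G × ℕ × ℤ`. -/
def levelShift (G : Type*) : Equiv.Perm (G × ℕ × ℤ) :=
  (Equiv.refl G).prodCongr ((Equiv.refl ℕ).prodCongr (Equiv.addRight 1))

theorem levelShift_apply {G : Type*} (y : G × ℕ × ℤ) :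
    levelShift G y = (y.1, y.2.1, y.2.2 + 1) := rfl

/-- Conjugation by the shift turns the action on levels `≥ 0` into the one on levels `≥ 1`; the
quotient of the two acts on level `0` alone. -/
theorem levelMul_eq_commutator {G : Type*} [Group G] (g : G) :
    levelMul G (· = 0) g = ⁅levelMul G (0 ≤ ·) g, levelShift G⁆ := by
  rw [commutatorElement_def, eq_mul_inv_iff_mul_eq, eq_mul_inv_iff_mul_eq]
  ext1 ⟨h, n, k⟩
  simp only [Equiv.Perm.mul_apply, levelShift_apply, levelMul_apply]
  rcases lt_trichotomy k (-1) with hk | rfl | hk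
  · simp [show ¬ 0 ≤ k by omega, show ¬ k + 1 = 0 by omega, show ¬ 0 ≤ k + 1 by omega]
  · simp
  · simp [show 0 ≤ k by omega, show ¬ k + 1 = 0 by omega, show 0 ≤ k + 1 by omega]

theorem levelMul_zero_injective (G : Type*) [Group G] :
    Function.Injective (levelMul G (· = 0)) := by
  intro g h hgh
  have := congrArg Prod.fst (Equiv.congr_fun hgh (1, 0, 0))
  simpa [levelMul_apply] using this

/-- The permutation matrices, as invertible endomorphisms of a free module. -/
noncomputable def permUnits (R X : Type*) [Ring R] :
    Equiv.Perm X →* (Module.End R (X →₀ R))ˣ :=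
  MonoidHom.toHomUnits
    { toFun := fun ρ => Finsupp.lmapDomain R R ρ
      map_one' := Finsupp.lmapDomain_id R R
      map_mul' := fun ρ τ => Finsupp.lmapDomain_comp R R τ ρ }

theorem permUnits_single {R X : Type*} [Ring R] (ρ : Equiv.Perm X) (y : X) (r : R) :
    (permUnits R X ρ : Module.End R (X →₀ R)) (Finsupp.single y r) = Finsupp.single (ρ y) r :=
  Finsupp.mapDomain_single

theorem permUnits_injective (R X : Type*) [Ring R] [Nontrivial R] :
    Function.Injective (permUnits R X) := by
  intro ρ τ h
  ext1 y
  have := congrArg (fun a : (Module.End R (X →₀ R))ˣ =>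
    (a : Module.End R (X →₀ R)) (Finsupp.single y 1)) h
  simp only [permUnits_single] at this
  exact Finsupp.single_left_injective one_ne_zero this

theorem exists_isPerfect_overgroup {G : Type v} [Group G] [Group.FG G] {x : G} (hx : x ≠ 1) :
    ∃ (H : Type v) (_ : Group H) (_ : Group.FG H) (_ : Group.IsPerfect H) (φ : G →* H),
      Function.Injective φ ∧ Subgroup.normalClosure {φ x} = ⊤ := by
  classical
  have : Countable G := Group.FG.countable G
  obtain ⟨e⟩ : Nonempty (G × ℕ × ℤ ≃ ℕ) := nonempty_equiv_of_countable
  let K := ZMod 2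
  let V := G × ℕ × ℤ →₀ K
  let U := permUnits K (G × ℕ × ℤ)
  -- `q` stores every basis vector at level `0` under group coordinate `1`, with its code in the `ℕ`
  -- coordinate. `p` decodes only what has group coordinate `x`. Since `x ≠ 1`, `p` kills the image
  -- of `q` but inverts `q` after `x` has acted.
  let q : Module.End K V := Finsupp.lmapDomain K K fun y => (1, e y, 0)
  let p : Module.End K V := Finsupp.linearCombination K fun y =>
    if y.1 = x ∧ y.2.2 = 0 then Finsupp.single (e.symm y.2.1) (1 : K) else 0
  -- Monoid generators are used because a subring need not be closed under inverses of units.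
  obtain ⟨T, hT, fT⟩ := Monoid.fg_iff.1 ((Group.fg_iff_monoid_fg (G := G)).1 inferInstance)
  let f : G →* (Module.End K V)ˣ := U.comp (levelMul G (0 ≤ ·))
  let S : Set (Module.End K V) := (fun g => (f g : Module.End K V)) '' T ∪
    {(U (levelShift G)).val, (U (levelShift G))⁻¹.val, p, q}
  refine exists_isPerfect_overgroup_of_units (S := S) ((fT.image _).union (by simp)) f
    (U (levelShift G)) (U.comp (levelMul G (· = 0)))
    ((permUnits_injective K _).comp (levelMul_zero_injective G)) ?_ ?_ ?_ ?_ x (p := p) (q := q)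
    ?_ ?_ ?_
  · intro g
    simp only [f, MonoidHom.comp_apply, levelMul_eq_commutator, map_commutatorElement]
  · intro g
    have hg : g ∈ Submonoid.closure T := hT ▸ Submonoid.mem_top g
    induction hg using Submonoid.closure_induction with
    | mem g hg => exact Subring.subset_closure (Or.inl ⟨g, hg, rfl⟩)
    | one => rw [map_one]; exact one_mem _
    | mul g h _ _ hg hh => rw [map_mul]; exact mul_mem hg hh
  · exact Subring.subset_closure (Or.inr (by simp))
  · exact Subring.subset_closure (Or.inr (by simp))
  · exact Subring.subset_closure (Or.inr (by simp))
  · exact Subring.subset_closure (Or.inr (by simp))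
  · refine Finsupp.lhom_ext fun y r => ?_
    have hq (y : G × ℕ × ℤ) (r : K) : q (Finsupp.single y r) = Finsupp.single (1, e y, 0) r :=
      Finsupp.mapDomain_single
    simp only [Module.End.mul_apply, LinearMap.sub_apply, Module.End.one_apply, hq]
    rw [MonoidHom.comp_apply, permUnits_single, map_sub]
    simp [p, levelMul_apply, Finsupp.linearCombination_single, hx.symm]
    exact Finsupp.smul_single_one y r

/-- A finitely generated group with a nontrivial element `x` embeds in a group that is generated by
the image of `x` and one further element. -/
theorem exists_two_generator_overgroup {G : Type v} [Group G] [Group.FG G] {x : G} (hx : x ≠ 1) :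
    ∃ (D : Type v) (_ : Group D) (_ : Countable D) (ι : G →* D) (t : D), Function.Injective ι ∧
      Subgroup.closure {ι x, t} = ⊤ := by
  obtain ⟨H, _, _, _, φ, hφ, hφx⟩ := exists_isPerfect_overgroup hx
  obtain ⟨W, _, ι, t, hι, hle⟩ := exists_two_generator_overgroup_of_isPerfect (φ x) hφx
  set D := Subgroup.closure {ι (φ x), t} with hD
  have : Group.FG D := (Group.fg_iff_subgroup_fg _).2 ((Subgroup.fg_iff _).2
    ⟨_, rfl, by simp⟩)
  refine ⟨D, inferInstance, Group.FG.countable D,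
    (ι.comp φ).codRestrict D fun g => hle ⟨φ g, rfl⟩, ⟨t, Subgroup.subset_closure (by simp)⟩,
    fun g h hgh => hφ (hι (congrArg Subtype.val hgh)), ?_⟩
  apply Subgroup.map_injective D.subtype_injective
  rw [MonoidHom.map_closure, ← MonoidHom.range_eq_map, Subgroup.range_subtype]
  simp [Set.image_pair, hD]

end

/-! ### Deck transformations and the fundamental group. -/

namespace RegularCover

variable {S : Type u} [TopologicalSpace S] (C : RegularCover S)

instance : MulAction C.Deck C.E where
  smul d e := (d : C.E ≃ₜ C.E) e
  one_smul _ := rfl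
  mul_smul _ _ _ := rfl

theorem p_deck_smul (d : C.Deck) (e : C.E) : C.p (d • e) = C.p e := d.2 e

variable {C} in
/-- A deck transformation is determined by the image of one point. -/
theorem deck_ext {d d' : C.Deck} {e : C.E} (h : d • e = d' • e) : d = d' := by
  have := C.isCovering.eq_of_comp_eq (d : C.E ≃ₜ C.E).continuous (d' : C.E ≃ₜ C.E).continuous
    (funext fun e => (C.p_deck_smul d e).trans (C.p_deck_smul d' e).symm) e h
  exact Subtype.ext (Homeomorph.ext fun e => congrFun this e)

/-- The action is free because a deck transformation is a lift of `p`, determined by one value;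
regularity makes the orbits equal to the fibres. -/
theorem isQuotientCoveringMap : IsQuotientCoveringMap C.p C.Deck := by
  refine (isQuotientCoveringMap_iff_isCoveringMap_and _ _).2
    ⟨C.isCovering, C.surjective, ⟨fun d => (d : C.E ≃ₜ C.E).continuous⟩, ?_, ?_⟩
  · exact { left_cancel' := fun d _ _ h => (d : C.E ≃ₜ C.E).injective h
            right_cancel' := fun _ _ _ h => deck_ext h }
  · intro e₁ e₂
    constructor
    · intro h
      obtain ⟨d, hd, hde⟩ := C.regular e₂ e₁ h.symm
      exact ⟨⟨d, hd⟩, hde⟩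
    · rintro ⟨d, rfl⟩
      exact C.p_deck_smul d e₂

theorem deckOfLoop_iff_liftPath {e₀ : C.E} {γ : C(I, S)} (h : γ 0 = C.p e₀) (d : C.Deck) :
    C.DeckOfLoop e₀ γ d ↔ d • e₀ = C.isCovering.liftPath γ e₀ h 1 := by
  constructor
  · rintro ⟨Γ, hΓ, h0, h1⟩
    rw [← (C.isCovering.eq_liftPath_iff' h (Γ := Γ)).2 ⟨funext hΓ, h0⟩]
    exact h1.symm
  · intro hd
    exact ⟨C.isCovering.liftPath γ e₀ h, congrFun (C.isCovering.liftPath_lifts γ e₀ h),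
      C.isCovering.liftPath_zero γ e₀ h, hd.symm⟩

theorem exists_fundamentalGroup_hom (e₀ : C.E) :
    ∃ φ : FundamentalGroup S (C.p e₀) →* (C.Deck)ᵐᵒᵖ,
      (∀ (γ : Path (C.p e₀) (C.p e₀)) (d : C.Deck),
        φ (FundamentalGroup.fromPath (Path.Homotopic.Quotient.mk γ)) = MulOpposite.op d ↔
          C.DeckOfLoop e₀ γ.toContinuousMap d) ∧
      Function.Surjective φ ∧ φ.ker = (FundamentalGroup.map C.p e₀).range := by
  have hp := C.isQuotientCoveringMap
  let e : C.p ⁻¹' {C.p e₀} := ⟨e₀, rfl⟩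
  refine ⟨hp.fundamentalGroupToMulOpposite e, fun γ d => ?_,
    hp.fundamentalGroupToMulOpposite_surjective e, ?_⟩
  · rw [hp.fundamentalGroupToMulOpposite_apply_eq_Iff, C.deckOfLoop_iff_liftPath γ.source]
    rfl
  · rw [hp.ker_fundamentalGroupToMulOpposite, hp.ker_monodromyPerm e]
    congr 1
    ext γ
    exact (FundamentalGroup.mapOfEq_apply C.p rfl γ).trans
      (Path.Homotopic.Quotient.cast_rfl_rfl _)

end RegularCover

/-! ### Covers defined by labelled bands. -/

noncomputable section

open Topology Filter

/-- A quotient map `q` from `X` to `S` together with circle-valued functions `f i` on `S` whose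
supports are disjoint, and which lift through `exp (2 * π * ·)` to functions on `X` with values in
the unit interval. -/
structure BandSystem (ι X S : Type*) [TopologicalSpace X] [TopologicalSpace S] where
  q : C(X, S)
  q_surjective : Function.Surjective q
  τ : ι → C(X, ℝ)
  τ_nonneg : ∀ i z, 0 ≤ τ i z
  τ_le_one : ∀ i z, τ i z ≤ 1
  τ_disjoint : ∀ i j z, i ≠ j → τ i z = 0 ∨ τ j z = 0
  f : ι → C(S, Circle)
  f_q : ∀ i z, f i (q z) = Circle.exp (2 * Real.pi * τ i z)

theorem Circle.eq_one_or_eq_neg_one_of_im_eq_zero {z : Circle} (h : (z : ℂ).im = 0) :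
    (z : ℂ) = 1 ∨ (z : ℂ) = -1 := by
  have h1 := Circle.normSq_coe z
  rw [Complex.normSq_apply, h] at h1
  have : ((z : ℂ).re - 1) * ((z : ℂ).re + 1) = 0 := by linarith
  rcases mul_eq_zero.1 this with h2 | h2
  · left; apply Complex.ext <;> simp [h]; linarith
  · right; apply Complex.ext <;> simp [h]; linarith

namespace BandSystem

variable {ι X S : Type*} [TopologicalSpace X] [TopologicalSpace S] (B : BandSystem ι X S)
  {G : Type*} [Group G] (x : ι → G)

theorem im_f_q (i : ι) (z : X) :
    ((B.f i (B.q z) : Circle) : ℂ).im = Real.sin (2 * Real.pi * B.τ i z) := by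
  rw [B.f_q, Circle.coe_exp, Complex.exp_ofReal_mul_I_im]

theorem re_f_q (i : ι) (z : X) :
    ((B.f i (B.q z) : Circle) : ℂ).re = Real.cos (2 * Real.pi * B.τ i z) := by
  rw [B.f_q, Circle.coe_exp, Complex.exp_ofReal_mul_I_re]

theorem f_q_eq_one {i : ι} {z : X} (h : B.τ i z = 0 ∨ B.τ i z = 1) :
    ((B.f i (B.q z) : Circle) : ℂ) = 1 := by
  apply Complex.ext
  · rw [re_f_q]; rcases h with h | h <;> simp [h]
  · rw [im_f_q]; rcases h with h | h <;> simp [h]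

theorem f_q_ne_one {i : ι} {z : X} (h : 0 < B.τ i z) (h' : B.τ i z < 1) :
    ((B.f i (B.q z) : Circle) : ℂ) ≠ 1 := by
  intro h1
  have h2 := B.re_f_q i z
  rw [h1, Complex.one_re, eq_comm, Real.cos_eq_one_iff] at h2
  obtain ⟨n, hn⟩ := h2
  have h3 : (n : ℝ) = B.τ i z := by
    have := Real.pi_pos
    field_simp at hn
    linarith
  rw [← h3] at h h'
  have h4 : (0 : ℤ) < n := by exact_mod_cast h
  have h5 : n < (1 : ℤ) := by exact_mod_cast h'
  omega

theorem f_disjoint {i j : ι} (h : i ≠ j) (z : S) :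
    ((B.f i z : Circle) : ℂ) = 1 ∨ ((B.f j z : Circle) : ℂ) = 1 := by
  obtain ⟨z, rfl⟩ := B.q_surjective z
  exact (B.τ_disjoint i j z h).imp (fun h => B.f_q_eq_one (Or.inl h))
    (fun h => B.f_q_eq_one (Or.inl h))

/-- The open sets over which the cover is trivial. -/
def patch : Option ι → Set S
  | none => {z | ∀ i, ((B.f i z : Circle) : ℂ) ≠ -1}
  | some i => {z | ((B.f i z : Circle) : ℂ) ≠ 1}

open Classical in
/-- The index of a patch around a point. -/
def patchAt (z : S) : Option ι :=
  if h : ∃ i, ((B.f i z : Circle) : ℂ) = -1 then some h.choose else none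

theorem mem_patchAt (z : S) : z ∈ B.patch (B.patchAt z) := by
  unfold patchAt
  split_ifs with h
  · change ((B.f h.choose z : Circle) : ℂ) ≠ 1
    rw [h.choose_spec]
    norm_num
  · exact not_exists.1 h

theorem continuous_coe_f (i : ι) : Continuous fun z => ((B.f i z : Circle) : ℂ) :=
  continuous_subtype_val.comp (B.f i).continuous

theorem isOpen_patch [Finite ι] : ∀ a, IsOpen (B.patch a)
  | none => by
    have : B.patch none = ⋂ i, {z | ((B.f i z : Circle) : ℂ) ≠ -1} := by
      ext z; simp [patch]
    rw [this]
    exact isOpen_iInter_of_finite fun i => isOpen_ne_fun (B.continuous_coe_f i) continuous_const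
  | some i => isOpen_ne_fun (B.continuous_coe_f i) continuous_const

open Classical in
/-- The (discontinuous) functions whose quotients are the locally constant transition functions of
the cover. -/
def shift : Option ι → S → G
  | none, _ => 1
  | some i, z => if 0 < ((B.f i z : Circle) : ℂ).im then 1 else x i

theorem shift_some_eventuallyEq {i : ι} {z : S} (h1 : ((B.f i z : Circle) : ℂ) ≠ 1)
    (h2 : ((B.f i z : Circle) : ℂ) ≠ -1) :
    ∀ᶠ z' in 𝓝 z, B.shift x (some i) z' = B.shift x (some i) z := by
  have hc : Continuous fun z => ((B.f i z : Circle) : ℂ).im :=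
    Complex.continuous_im.comp (B.continuous_coe_f i)
  rcases lt_trichotomy ((B.f i z : Circle) : ℂ).im 0 with h | h | h
  · filter_upwards [hc.continuousAt.eventually (gt_mem_nhds h)] with z' hz'
    simp [shift, h.not_gt, hz'.not_gt]
  · rcases Circle.eq_one_or_eq_neg_one_of_im_eq_zero h with h | h
    · exact absurd h h1
    · exact absurd h h2
  · filter_upwards [hc.continuousAt.eventually (lt_mem_nhds h)] with z' hz'
    simp [shift, h, hz']

/-- `shift` can jump only where some `f i` is `1` or `-1`. The overlap of `none` with `some i`
avoids both values of `f i`, and patches `some i`, `some j` with `i ≠ j` are disjoint. -/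
theorem shift_mul_shift_inv_eventuallyEq : ∀ {a b : Option ι} {z : S}, z ∈ B.patch a →
    z ∈ B.patch b → ∀ᶠ z' in 𝓝 z, B.shift x a z' * (B.shift x b z')⁻¹ =
      B.shift x a z * (B.shift x b z)⁻¹
  | none, none, _, _, _ => Eventually.of_forall fun _ => rfl
  | none, some i, z, ha, hb => by
    filter_upwards [B.shift_some_eventuallyEq x hb (ha i)] with z' hz'
    rw [hz']; rfl
  | some i, none, z, ha, hb => by
    filter_upwards [B.shift_some_eventuallyEq x ha (hb i)] with z' hz'
    rw [hz']; rfl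
  | some i, some j, z, ha, hb => by
    obtain rfl : i = j := by
      by_contra hij
      exact (B.f_disjoint hij z).elim ha hb
    simp

open Classical in
/-- The global coordinate of the points of the tile with base coordinate `1`. -/
def tileShift (z : X) : G := if h : ∃ i, 1 / 2 ≤ B.τ i z then x h.choose else 1

theorem tileShift_eq {i : ι} {z : X} (h : 1 / 2 ≤ B.τ i z) : B.tileShift x z = x i := by
  have hex : ∃ i, 1 / 2 ≤ B.τ i z := ⟨i, h⟩
  rw [tileShift, dif_pos hex]
  congr 1
  by_contra hne
  have h1 := hex.choose_spec
  rcases B.τ_disjoint _ _ z hne with h2 | h2 <;> linarith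

theorem tileShift_eq_one {z : X} (h : ∀ i, B.τ i z < 1 / 2) : B.tileShift x z = 1 :=
  dif_neg (by simpa using h)

variable [Finite ι] [TopologicalSpace G] [DiscreteTopology G]

/-- The principal bundle with fibre `G` over `S` given by the transition functions `shift`. -/
def bundle : FiberBundleCore (Option ι) S G where
  baseSet := B.patch
  isOpen_baseSet := B.isOpen_patch
  indexAt := B.patchAt
  mem_baseSet_at := B.mem_patchAt
  -- Transition functions multiply on the right, so left multiplication commutes with them and is
  -- globally defined.
  coordChange a b z v := v * (B.shift x a z * (B.shift x b z)⁻¹)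
  coordChange_self a z _ v := by simp
  continuousOn_coordChange a b := by
    rintro ⟨z, v⟩ ⟨⟨ha, hb⟩, -⟩
    refine ContinuousAt.continuousWithinAt ?_
    have h := B.shift_mul_shift_inv_eventuallyEq x ha hb
    refine (continuous_snd.mul_const (B.shift x a z * (B.shift x b z)⁻¹)).continuousAt.congr ?_
    filter_upwards [continuous_fst.continuousAt.eventually h] with p hp
    rw [hp]
  coordChange_comp a b c z _ v := by group

/-- The total space of the cover. -/
abbrev Total : Type _ := (B.bundle x).TotalSpace

/-- The point over `z` with global coordinate `w`. -/
def point (z : S) (w : G) : B.Total x := ⟨z, w * (B.shift x (B.patchAt z) z)⁻¹⟩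

theorem exists_point (e : B.Total x) : ∃ w, e = B.point x e.proj w := by
  refine ⟨(show G from e.2) * B.shift x (B.patchAt e.proj) e.proj, ?_⟩
  obtain ⟨z, v⟩ := e
  unfold point
  congr 1
  exact (mul_inv_cancel_right (show G from v) _).symm

theorem point_injective (z : S) : Function.Injective (B.point x z) := by
  intro w w' h
  have h1 := congrArg (fun e : B.Total x => (B.bundle x).localTrivAt z e) h
  have h2 : w * (B.shift x (B.patchAt z) z)⁻¹ = w' * (B.shift x (B.patchAt z) z)⁻¹ := by
    simpa [point] using h1
  exact mul_right_cancel h2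

theorem localTriv_point (a : Option ι) (z : S) (w : G) :
    (B.bundle x).localTriv a (B.point x z w) = (z, w * (B.shift x a z)⁻¹) := by
  rw [FiberBundleCore.localTriv_apply]
  refine Prod.ext rfl ?_
  change w * (B.shift x (B.patchAt z) z)⁻¹ * (B.shift x (B.patchAt z) z * (B.shift x a z)⁻¹) = _
  group

/-- Continuity is tested in one chart: the global coordinate `w` may jump, provided that `shift`
jumps with it. -/
theorem continuousAt_point {Y : Type*} [TopologicalSpace Y] {c : Y → S} {w : Y → G} {y : Y}
    (hc : ContinuousAt c y) (a : Option ι) (ha : c y ∈ B.patch a)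
    (hw : ∀ᶠ y' in 𝓝 y, w y' * (B.shift x a (c y'))⁻¹ = w y * (B.shift x a (c y))⁻¹) :
    ContinuousAt (fun y => B.point x (c y) (w y)) y := by
  have hsource : (fun y => B.point x (c y) (w y)) ⁻¹' ((B.bundle x).localTriv a).source ∈ 𝓝 y :=
    hc.preimage_mem_nhds ((B.isOpen_patch a).mem_nhds ha)
  refine (((B.bundle x).localTriv a).toOpenPartialHomeomorph.continuousAt_iff_continuousAt_comp_left
    hsource).2 ?_
  have : ContinuousAt (fun y' => (c y', w y * (B.shift x a (c y))⁻¹)) y :=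
    hc.prodMk continuousAt_const
  refine this.congr ?_
  filter_upwards [hw] with y' hy'
  rw [← hy']
  exact (B.localTriv_point x a (c y') (w y')).symm

theorem isCoveringMap_proj : IsCoveringMap (B.bundle x).proj :=
  FiberBundle.isCoveringMap (F := G) (E := (B.bundle x).Fiber)

/-- Left multiplication in the fibres. -/
def leftMul (k : G) : B.Total x → B.Total x := fun e => ⟨e.proj, k * (show G from e.2)⟩

theorem leftMul_point (k : G) (z : S) (w : G) :
    B.leftMul x k (B.point x z w) = B.point x z (k * w) := by
  unfold leftMul point
  congr 1
  exact (mul_assoc k w _).symm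

theorem continuous_leftMul (k : G) : Continuous (B.leftMul x k) := by
  refine continuous_iff_continuousAt.2 fun e => ?_
  have hproj := (B.bundle x).continuous_proj
  have hsource : B.leftMul x k ⁻¹' ((B.bundle x).localTrivAt e.proj).source ∈ 𝓝 e :=
    hproj.continuousAt.preimage_mem_nhds
      ((B.isOpen_patch _).mem_nhds (B.mem_patchAt e.proj))
  refine (((B.bundle x).localTrivAt
    e.proj).toOpenPartialHomeomorph.continuousAt_iff_continuousAt_comp_left hsource).2 ?_
  have h1 : ContinuousAt ((B.bundle x).localTrivAt e.proj) e :=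
    ((B.bundle x).localTrivAt e.proj).continuousAt ((B.bundle x).mk_mem_localTrivAt_source _ _)
  have h2 : Continuous fun p : S × G => (p.1, k * p.2) := by fun_prop
  refine (h2.continuousAt.comp h1).congr (Eventually.of_forall fun e' => ?_)
  exact Prod.ext rfl (mul_assoc k _ _).symm

/-- Left multiplication in the fibres, as a homeomorphism. -/
def leftMulHomeomorph (k : G) : B.Total x ≃ₜ B.Total x where
  toFun := B.leftMul x k
  invFun := B.leftMul x k⁻¹
  left_inv e := by
    obtain ⟨w, hw⟩ := B.exists_point x e
    rw [hw, leftMul_point, leftMul_point, inv_mul_cancel_left]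
  right_inv e := by
    obtain ⟨w, hw⟩ := B.exists_point x e
    rw [hw, leftMul_point, leftMul_point, mul_inv_cancel_left]
  continuous_toFun := B.continuous_leftMul x k
  continuous_invFun := B.continuous_leftMul x k⁻¹

/-- The action of `G` on the cover by deck transformations. -/
def leftMulDeck : G →* deckGroup (B.bundle x).proj where
  toFun k := ⟨B.leftMulHomeomorph x k, fun _ => rfl⟩
  map_one' := by
    refine Subtype.ext (Homeomorph.ext fun e => ?_)
    obtain ⟨w, hw⟩ := B.exists_point x e
    change B.leftMul x 1 e = e
    rw [hw, leftMul_point, one_mul]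
  map_mul' k l := by
    refine Subtype.ext (Homeomorph.ext fun e => ?_)
    obtain ⟨w, hw⟩ := B.exists_point x e
    change B.leftMul x (k * l) e = B.leftMul x k (B.leftMul x l e)
    rw [hw, leftMul_point, leftMul_point, leftMul_point, mul_assoc]

theorem leftMulDeck_point (k : G) (z : S) (w : G) :
    (B.leftMulDeck x k : B.Total x ≃ₜ B.Total x) (B.point x z w) = B.point x z (k * w) :=
  B.leftMul_point x k z w

/-- The lift of `X` to the cover. -/
def tile (h : G) (z : X) : B.Total x := B.point x (B.q z) (h * B.tileShift x z)

/-- Inside band `i`, the jump of `tileShift` at `τ = 1/2` cancels that of `shift` at `f i = -1`.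
Elsewhere every `τ` is `0` or `1`, and `tileShift` is locally constant. -/
theorem continuous_tile (h : G) : Continuous (B.tile x h) := by
  refine continuous_iff_continuousAt.2 fun z => ?_
  have hq := B.q.continuous.continuousAt (x := z)
  by_cases hz : ∃ i, 0 < B.τ i z ∧ B.τ i z < 1
  · obtain ⟨i, h0, h1⟩ := hz
    refine B.continuousAt_point x hq (some i) (B.f_q_ne_one h0 h1) ?_
    have key : ∀ z', 0 < B.τ i z' → B.τ i z' < 1 →
        h * B.tileShift x z' * (B.shift x (some i) (B.q z'))⁻¹ = h := by
      intro z' h0' h1'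
      have hpi := Real.pi_pos
      by_cases hh : 1 / 2 ≤ B.τ i z'
      · have : ¬ 0 < ((B.f i (B.q z') : Circle) : ℂ).im := by
          rw [B.im_f_q, not_lt, ← neg_nonneg, ← Real.sin_sub_pi]
          exact Real.sin_nonneg_of_nonneg_of_le_pi (by nlinarith) (by nlinarith)
        simp [B.tileShift_eq x hh, shift, this]
      · push Not at hh
        have : 0 < ((B.f i (B.q z') : Circle) : ℂ).im := by
          rw [B.im_f_q]
          exact Real.sin_pos_of_pos_of_lt_pi (by positivity) (by nlinarith)
        rw [B.tileShift_eq_one x]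
        · simp [shift, this]
        · intro j
          by_cases hij : i = j
          · exact hij ▸ hh
          · rcases B.τ_disjoint i j z' hij with h2 | h2 <;> linarith
    filter_upwards [(B.τ i).continuous.continuousAt.eventually (lt_mem_nhds h0),
      (B.τ i).continuous.continuousAt.eventually (gt_mem_nhds h1)] with z' h0' h1'
    rw [key z' h0' h1', key z h0 h1]
  · have hz' : ∀ i, B.τ i z = 0 ∨ B.τ i z = 1 := by
      intro i
      by_contra! hne
      exact hz ⟨i, (B.τ_nonneg i z).lt_of_ne hne.1.symm, (B.τ_le_one i z).lt_of_ne hne.2⟩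
    refine B.continuousAt_point x hq none (fun i => ?_) ?_
    · rw [B.f_q_eq_one (hz' i)]; norm_num
    have key : ∀ᶠ z' in 𝓝 z, B.tileShift x z' = B.tileShift x z := by
      by_cases h1 : ∃ i, B.τ i z = 1
      · obtain ⟨i, hi⟩ := h1
        have hlt : 1 / 2 < B.τ i z := by rw [hi]; norm_num
        filter_upwards [(B.τ i).continuous.continuousAt.eventually (lt_mem_nhds hlt)] with z' h'
        rw [B.tileShift_eq x h'.le, B.tileShift_eq x hlt.le]
      · have h0 : ∀ i, B.τ i z < 1 / 2 := fun i => by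
          rcases hz' i with h | h
          · rw [h]; norm_num
          · exact absurd ⟨i, h⟩ h1
        have : ∀ᶠ z' in 𝓝 z, ∀ i, B.τ i z' < 1 / 2 := eventually_all.2 fun i =>
          (B.τ i).continuous.continuousAt.eventually (gt_mem_nhds (h0 i))
        filter_upwards [this] with z' h'
        rw [B.tileShift_eq_one x h', B.tileShift_eq_one x h0]
    filter_upwards [key] with z' h'
    simp [shift, h']

theorem tile_eq {h : G} {z : X} {i : ι} (hi : B.τ i z = 1) :
    B.tile x h z = B.point x (B.q z) (h * x i) := by
  rw [tile, B.tileShift_eq x (i := i) (by rw [hi]; norm_num)]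

theorem tile_eq_of_eq_zero {h : G} {z : X} (hz : ∀ i, B.τ i z = 0) :
    B.tile x h z = B.point x (B.q z) h := by
  rw [tile, B.tileShift_eq_one x (fun i => by rw [hz]; norm_num), mul_one]

variable {x} in
-- A path in `X` from `z₀` to `z₁ i`, lifted by a tile, joins coordinate `h` to `h * x i` over the
-- base point. Since the `x i` generate, the whole fibre is joined, and tiles reach every other
-- point.
theorem pathConnectedSpace_total [PathConnectedSpace X]
    (hx : Subgroup.closure (Set.range x) = ⊤) (z₀ : X) (h₀ : ∀ i, B.τ i z₀ = 0) (z₁ : ι → X)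
    (h₁ : ∀ i, B.τ i (z₁ i) = 1) (hz : ∀ i, B.q (z₁ i) = B.q z₀) :
    PathConnectedSpace (B.Total x) := by
  have htile (h : G) (z z' : X) : Joined (B.tile x h z) (B.tile x h z') :=
    (PathConnectedSpace.joined z z').map (B.continuous_tile x h)
  have hstep (h : G) (i : ι) : Joined (B.point x (B.q z₀) h) (B.point x (B.q z₀) (h * x i)) := by
    have := htile h z₀ (z₁ i)
    rwa [B.tile_eq_of_eq_zero x h₀, B.tile_eq x (h₁ i), hz i] at this
  have hall (h : G) : Joined (B.point x (B.q z₀) 1) (B.point x (B.q z₀) h) := by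
    have hh : h ∈ Subgroup.closure (Set.range x) := hx ▸ Subgroup.mem_top h
    induction hh using Subgroup.closure_induction_right with
    | one => exact Joined.refl _
    | mul_right h k _ hk ih =>
      obtain ⟨i, rfl⟩ := hk
      exact ih.trans (hstep h i)
    | mul_inv_cancel h k _ hk ih =>
      obtain ⟨i, rfl⟩ := hk
      refine ih.trans (Joined.symm ?_)
      have := hstep (h * (x i)⁻¹) i
      rwa [inv_mul_cancel_right] at this
  have hbase (e : B.Total x) : Joined (B.point x (B.q z₀) 1) e := by
    obtain ⟨w, hw⟩ := B.exists_point x e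
    obtain ⟨z, hz⟩ := B.q_surjective e.proj
    have := htile (w * (B.tileShift x z)⁻¹) z₀ z
    rw [B.tile_eq_of_eq_zero x h₀, tile, inv_mul_cancel_right, hz, ← hw] at this
    exact (hall _).trans this
  exact ⟨⟨B.point x (B.q z₀) 1⟩, fun e e' => (hbase e).symm.trans (hbase e')⟩

end BandSystem

/-! ### The bands in the polygon. -/

namespace StandardSurface

/-- The angle of a side of the polygon. -/
def sideAngle (g : ℕ) : ℝ := 2 * Real.pi / (4 * g)

theorem sideAngle_mul {g : ℕ} (hg : 0 < g) : sideAngle g * (4 * g) = 2 * Real.pi := by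
  have : (g : ℝ) ≠ 0 := by positivity
  unfold sideAngle
  field_simp

theorem sideAngle_pos {g : ℕ} (hg : 0 < g) : 0 < sideAngle g := by
  have := Real.pi_pos
  unfold sideAngle
  positivity

theorem cos_sideAngle_mul_le {g : ℕ} (hg : 0 < g) {t : ℝ} (h : 3 / 2 ≤ |t|)
    (h' : |t| ≤ 4 * g - 3 / 2) : Real.cos (sideAngle g * t) ≤ Real.cos (sideAngle g * (3 / 2)) := by
  have hδ := sideAngle_pos hg
  have hm := sideAngle_mul hg
  rw [← Real.cos_abs, abs_mul, abs_of_pos hδ]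
  rcases le_total (sideAngle g * |t|) Real.pi with hle | hle
  · exact Real.cos_le_cos_of_nonneg_of_le_pi (by positivity) hle (by gcongr)
  · rw [← Real.cos_two_pi_sub]
    refine Real.cos_le_cos_of_nonneg_of_le_pi (by positivity) (by linarith) ?_
    nlinarith

/-- The height of a point of the disc in the direction of the midpoint of the sides
`aᵢ bᵢ aᵢ⁻¹`. -/
def height (g : ℕ) (i : Fin g) (z : Disc) : ℝ :=
  (z : ℂ).re * Real.cos (sideAngle g * (4 * (i : ℕ) + 3 / 2)) +
    (z : ℂ).im * Real.sin (sideAngle g * (4 * (i : ℕ) + 3 / 2))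

theorem height_boundaryPoint (g : ℕ) (i : Fin g) (t : ℝ) :
    height g i (boundaryPoint g t) = Real.cos (sideAngle g * (t - (4 * (i : ℕ) + 3 / 2))) := by
  have h : 2 * Real.pi * t / (4 * g) = sideAngle g * t := by unfold sideAngle; ring
  have hre : (boundaryPoint g t : ℂ).re = Real.cos (sideAngle g * t) := by
    rw [← h]; exact Complex.exp_ofReal_mul_I_re _
  have him : (boundaryPoint g t : ℂ).im = Real.sin (sideAngle g * t) := by
    rw [← h]; exact Complex.exp_ofReal_mul_I_im _
  rw [height, hre, him, mul_sub, Real.cos_sub]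

theorem re_mul_cos_add_im_mul_sin_le (z : Disc) (c : ℝ) :
    |(z : ℂ).re * Real.cos c + (z : ℂ).im * Real.sin c| ≤ 1 := by
  have hz : ‖(z : ℂ)‖ ≤ 1 := mem_closedBall_zero_iff.1 z.2
  have h1 : (z : ℂ).re ^ 2 + (z : ℂ).im ^ 2 ≤ 1 := by
    have h2 := Complex.sq_norm (z : ℂ)
    rw [Complex.normSq_apply] at h2
    have h3 : ‖(z : ℂ)‖ ^ 2 ≤ 1 := pow_le_one₀ (norm_nonneg _) hz
    nlinarith
  have h4 := Real.sin_sq_add_cos_sq c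
  refine abs_le_one_iff_mul_self_le_one.2 ?_
  nlinarith [sq_nonneg ((z : ℂ).re * Real.sin c - (z : ℂ).im * Real.cos c)]

/-- The two heights add up to at most `2 * |cos ε|`, where `ε` is half the angle between the
directions. As `|ε|` lies between `2 * δ` and `π - 2 * δ`, both heights cannot exceed `cos (3 * δ /
2)`. -/
theorem height_le_or_height_le {g : ℕ} {i j : Fin g} (hij : i ≠ j) (z : Disc) :
    height g i z ≤ Real.cos (sideAngle g * (3 / 2)) ∨
      height g j z ≤ Real.cos (sideAngle g * (3 / 2)) := by
  have hg : 0 < g := i.pos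
  by_contra! h
  set δ := sideAngle g
  set γ := δ * (2 * (i : ℕ) + 2 * (j : ℕ) + 3 / 2) with hγ
  set ε := δ * (2 * ((i : ℕ) : ℝ) - 2 * (j : ℕ)) with hε
  have hsum : height g i z + height g j z =
      2 * (Real.cos ε * ((z : ℂ).re * Real.cos γ + (z : ℂ).im * Real.sin γ)) := by
    have h1 : δ * (4 * ((i : ℕ) : ℝ) + 3 / 2) = γ + ε := by rw [hγ, hε]; ring
    have h2 : δ * (4 * ((j : ℕ) : ℝ) + 3 / 2) = γ - ε := by rw [hγ, hε]; ring
    unfold height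
    rw [h1, h2, Real.cos_add, Real.cos_sub, Real.sin_add, Real.sin_sub]
    ring
  have habs : |(2 * ((i : ℕ) : ℝ) - 2 * (j : ℕ))| ∈ Set.Icc (2 : ℝ) (2 * g - 2) := by
    have hi := i.2
    have hj := j.2
    have hne : (i : ℕ) ≠ j := fun h => hij (Fin.ext h)
    rcases lt_or_gt_of_ne hne with hlt | hlt
    · rw [abs_of_nonpos]
      · constructor
        · have : ((i : ℕ) : ℝ) + 1 ≤ (j : ℕ) := by exact_mod_cast hlt
          linarith
        · have : ((j : ℕ) : ℝ) + 1 ≤ g := by exact_mod_cast hj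
          have : (0 : ℝ) ≤ (i : ℕ) := by positivity
          linarith
      · have : ((i : ℕ) : ℝ) ≤ (j : ℕ) := by exact_mod_cast hlt.le
        linarith
    · rw [abs_of_nonneg]
      · constructor
        · have : ((j : ℕ) : ℝ) + 1 ≤ (i : ℕ) := by exact_mod_cast hlt
          linarith
        · have : ((i : ℕ) : ℝ) + 1 ≤ g := by exact_mod_cast hi
          have : (0 : ℝ) ≤ (j : ℕ) := by positivity
          linarith
      · have : ((j : ℕ) : ℝ) ≤ (i : ℕ) := by exact_mod_cast hlt.le
        linarith
  have hle1 : Real.cos ε ≤ Real.cos (δ * (3 / 2)) :=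
    cos_sideAngle_mul_le hg (by linarith [habs.1]) (by linarith [habs.2])
  have hle2 : -Real.cos ε ≤ Real.cos (δ * (3 / 2)) := by
    rw [← Real.cos_abs, hε, abs_mul, abs_of_pos (sideAngle_pos hg), ← Real.cos_pi_sub]
    have hpi : Real.pi = δ * (2 * g) := by linarith [sideAngle_mul hg]
    rw [hpi, ← mul_sub]
    have hnn : 0 ≤ 2 * (g : ℝ) - |(2 * ((i : ℕ) : ℝ) - 2 * (j : ℕ))| := by linarith [habs.2]
    refine cos_sideAngle_mul_le hg ?_ ?_ <;> rw [abs_of_nonneg hnn] <;> linarith [habs.1, habs.2]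
  have hmul : Real.cos ε * ((z : ℂ).re * Real.cos γ + (z : ℂ).im * Real.sin γ) ≤
      |Real.cos ε| := by
    refine (le_abs_self _).trans ?_
    rw [abs_mul]
    exact mul_le_of_le_one_right (abs_nonneg _) (re_mul_cos_add_im_mul_sin_le z γ)
  have := abs_le'.2 ⟨hle1, hle2⟩
  linarith

/-- The function on the disc that interpolates, across the band that joins the sides `aᵢ` and
`aᵢ⁻¹`, between `0` outside and `1` at the side `bᵢ`. -/
def bandHeight (g : ℕ) (i : Fin g) (z : Disc) : ℝ :=
  max 0 (min 1 ((height g i z - Real.cos (sideAngle g * (3 / 2))) /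
    (Real.cos (sideAngle g * (1 / 2)) - Real.cos (sideAngle g * (3 / 2)))))

theorem cos_lt_cos_sideAngle {g : ℕ} (hg : 0 < g) :
    Real.cos (sideAngle g * (3 / 2)) < Real.cos (sideAngle g * (1 / 2)) := by
  have hδ := sideAngle_pos hg
  have hm := sideAngle_mul hg
  have h1 : (1 : ℝ) ≤ g := by exact_mod_cast hg
  refine Real.cos_lt_cos_of_nonneg_of_le_pi (by positivity) ?_ (by linarith)
  nlinarith

theorem continuous_bandHeight (g : ℕ) (i : Fin g) : Continuous (bandHeight g i) := by
  unfold bandHeight height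
  fun_prop

theorem bandHeight_eq_zero {g : ℕ} {i : Fin g} {z : Disc}
    (h : height g i z ≤ Real.cos (sideAngle g * (3 / 2))) : bandHeight g i z = 0 := by
  have := cos_lt_cos_sideAngle i.pos
  refine max_eq_left (min_le_of_right_le (div_nonpos_of_nonpos_of_nonneg ?_ ?_)) <;> linarith

theorem bandHeight_eq_one {g : ℕ} {i : Fin g} {z : Disc}
    (h : Real.cos (sideAngle g * (1 / 2)) ≤ height g i z) : bandHeight g i z = 1 := by
  have := cos_lt_cos_sideAngle i.pos
  rw [bandHeight, min_eq_left, max_eq_right zero_le_one]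
  rw [one_le_div (by linarith)]
  linarith

theorem bandHeight_boundaryPoint_eq_zero {g : ℕ} {i : Fin g} {t : ℝ}
    (h : 3 / 2 ≤ |t - (4 * (i : ℕ) + 3 / 2)|) (h' : |t - (4 * (i : ℕ) + 3 / 2)| ≤ 4 * g - 3 / 2) :
    bandHeight g i (boundaryPoint g t) = 0 := by
  apply bandHeight_eq_zero
  rw [height_boundaryPoint]
  exact cos_sideAngle_mul_le i.pos h h'

theorem bandHeight_boundaryPoint_eq_one {g : ℕ} {i : Fin g} {s : ℝ} (h : s ∈ I) :
    bandHeight g i (boundaryPoint g (4 * (i : ℕ) + 1 + s)) = 1 := by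
  apply bandHeight_eq_one
  have hδ := sideAngle_pos i.pos
  have hm := sideAngle_mul i.pos
  have h1 : (1 : ℝ) ≤ g := by exact_mod_cast i.pos
  have h2 : |s - 1 / 2| ≤ 1 / 2 := abs_le.2 ⟨by linarith [h.1], by linarith [h.2]⟩
  rw [height_boundaryPoint, show (4 * ((i : ℕ) : ℝ) + 1 + s - (4 * (i : ℕ) + 3 / 2)) = s - 1 / 2 by
    ring, ← Real.cos_abs (_ * (s - 1 / 2)), abs_mul, abs_of_pos hδ]
  refine Real.cos_le_cos_of_nonneg_of_le_pi (by positivity) (by nlinarith) (by gcongr)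

theorem bandHeight_boundaryPoint_of_ne {g : ℕ} {i j : Fin g} (hij : i ≠ j) {s : ℝ}
    (h : s ∈ Set.Icc (0 : ℝ) 4) : bandHeight g j (boundaryPoint g (4 * (i : ℕ) + s)) = 0 := by
  have hne : (i : ℕ) ≠ j := fun h => hij (Fin.ext h)
  have hi : ((i : ℕ) : ℝ) + 1 ≤ g := by exact_mod_cast i.2
  have hj : ((j : ℕ) : ℝ) + 1 ≤ g := by exact_mod_cast j.2
  have hi0 : (0 : ℝ) ≤ (i : ℕ) := by positivity
  have hj0 : (0 : ℝ) ≤ (j : ℕ) := by positivity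
  have := h.1
  have := h.2
  rcases lt_or_gt_of_ne hne with hlt | hlt
  · have h1 : ((i : ℕ) : ℝ) + 1 ≤ (j : ℕ) := by exact_mod_cast hlt
    apply bandHeight_boundaryPoint_eq_zero <;> rw [abs_of_nonpos] <;> linarith
  · have h1 : ((j : ℕ) : ℝ) + 1 ≤ (i : ℕ) := by exact_mod_cast hlt
    apply bandHeight_boundaryPoint_eq_zero <;> rw [abs_of_nonneg] <;> linarith

theorem bandHeight_boundaryPoint_self {g : ℕ} {i : Fin g} {s : ℝ} (h : s ∈ I) :
    bandHeight g i (boundaryPoint g (4 * (i : ℕ) + 4 - s)) = 0 := by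
  have h1 : (1 : ℝ) ≤ g := by exact_mod_cast i.pos
  have := h.1
  have := h.2
  apply bandHeight_boundaryPoint_eq_zero <;> rw [abs_of_nonneg] <;> linarith

theorem bandHeight_corner {g : ℕ} (i j : Fin g) :
    bandHeight g j (boundaryPoint g (4 * (i : ℕ))) = 0 := by
  by_cases hij : i = j
  · subst hij
    have h1 : (1 : ℝ) ≤ g := by exact_mod_cast i.pos
    apply bandHeight_boundaryPoint_eq_zero <;> rw [abs_of_nonpos] <;> linarith
  · have := bandHeight_boundaryPoint_of_ne hij (s := 0) (by simp)
    rwa [add_zero] at this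

/-- Glued points of the `aⱼ` sides are mirror images in the axis of band `j`, so their heights
agree. On the two `bⱼ` sides the values are `1` and `0`, equal after exponentiation; sides with
another index give `0`. -/
theorem exp_bandHeight_of_gluing {g : ℕ} (j : Fin g) {z z' : Disc} (h : SideGluing g z z') :
    Circle.exp (2 * Real.pi * bandHeight g j z) = Circle.exp (2 * Real.pi * bandHeight g j z') := by
  cases h with
  | a i s =>
    have h0 := s.2.1
    have h1 := s.2.2
    by_cases hij : i = j
    · subst hij
      unfold bandHeight
      rw [height_boundaryPoint, height_boundaryPoint, ← Real.cos_neg]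
      ring_nf
    · rw [bandHeight_boundaryPoint_of_ne hij ⟨h0, by linarith⟩, add_sub_assoc,
        bandHeight_boundaryPoint_of_ne hij ⟨by linarith, by linarith⟩]
  | b i s =>
    have h0 := s.2.1
    have h1 := s.2.2
    by_cases hij : i = j
    · subst hij
      rw [bandHeight_boundaryPoint_eq_one s.2, bandHeight_boundaryPoint_self s.2]
      simp
    · rw [add_assoc, bandHeight_boundaryPoint_of_ne hij ⟨by linarith, by linarith⟩,
        add_sub_assoc, bandHeight_boundaryPoint_of_ne hij ⟨by linarith, by linarith⟩]

/-- The bands that join the sides `aᵢ` and `aᵢ⁻¹` of the polygon. -/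
def bandSystem (g : ℕ) {S : Type*} [TopologicalSpace S] (h : StandardSurface g ≃ₜ S) :
    BandSystem (Fin g) Disc S where
  q := (h : C(StandardSurface g, S)).comp ⟨Quot.mk _, continuous_quot_mk⟩
  q_surjective := h.surjective.comp Quot.mk_surjective
  τ i := ⟨bandHeight g i, continuous_bandHeight g i⟩
  τ_nonneg _ _ := le_max_left _ _
  τ_le_one _ _ := max_le zero_le_one (min_le_left _ _)
  τ_disjoint _ _ z hij := (height_le_or_height_le hij z).imp bandHeight_eq_zero bandHeight_eq_zero
  f i := ContinuousMap.comp
    ⟨Quot.lift (fun z => Circle.exp (2 * Real.pi * bandHeight g i z)) fun _ _ hz =>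
      exp_bandHeight_of_gluing i hz, continuous_quot_lift _ (Circle.exp.continuous.comp
        (continuous_const.mul (continuous_bandHeight g i)))⟩
    (h.symm : C(S, StandardSurface g))
  f_q _ z := congrArg _ (h.symm_apply_apply (Quot.mk _ z))

theorem mk_boundaryPoint_corner {g : ℕ} (i : Fin g) :
    ((Quot.mk _ (boundaryPoint g (4 * (i : ℕ) + 3)) : StandardSurface g) =
      Quot.mk _ (boundaryPoint g (4 * (i : ℕ)))) ∧
    ((Quot.mk _ (boundaryPoint g (4 * (i : ℕ) + 2)) : StandardSurface g) =
      Quot.mk _ (boundaryPoint g (4 * (i : ℕ)))) ∧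
    ((Quot.mk _ (boundaryPoint g (4 * (i : ℕ) + 1)) : StandardSurface g) =
      Quot.mk _ (boundaryPoint g (4 * (i : ℕ)))) ∧
    ((Quot.mk _ (boundaryPoint g (4 * (i : ℕ) + 4)) : StandardSurface g) =
      Quot.mk _ (boundaryPoint g (4 * (i : ℕ)))) := by
  -- The ends of the glued sides identify the corners in the order `4i, 4i+3, 4i+2, 4i+1, 4i+4`.
  have a0 := Quot.sound (SideGluing.a i 0)
  have a1 := Quot.sound (SideGluing.a i 1)
  have b0 := Quot.sound (SideGluing.b i 0)
  have b1 := Quot.sound (SideGluing.b i 1)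
  simp only [Set.Icc.coe_zero, Set.Icc.coe_one, add_zero, sub_zero] at a0 a1 b0 b1
  rw [show 4 * ((i : ℕ) : ℝ) + 3 - 1 = 4 * (i : ℕ) + 2 by ring] at a1
  rw [show 4 * ((i : ℕ) : ℝ) + 1 + 1 = 4 * (i : ℕ) + 2 by ring,
    show 4 * ((i : ℕ) : ℝ) + 4 - 1 = 4 * (i : ℕ) + 3 by ring] at b1
  exact ⟨a0.symm, b1.trans a0.symm, a1.trans (b1.trans a0.symm),
    b0.symm.trans (a1.trans (b1.trans a0.symm))⟩

theorem mk_boundaryPoint_eq {g : ℕ} (i : Fin g) :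
    (Quot.mk _ (boundaryPoint g (4 * (i : ℕ))) : StandardSurface g) =
      Quot.mk _ (boundaryPoint g 0) := by
  obtain ⟨i, hi⟩ := i
  induction i with
  | zero => simp
  | succ i ih =>
    rw [← ih (by omega), ← (mk_boundaryPoint_corner ⟨i, by omega⟩).2.2.2]
    congr 2
    push_cast
    ring

end StandardSurface

/-! ### The deck group of the band cover. -/

namespace BandSystem

variable {ι X : Type} {S : Type u} [TopologicalSpace X] [TopologicalSpace S]
  (B : BandSystem ι X S) {G : Type u} [Group G] (x : ι → G) [Finite ι] [TopologicalSpace G]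
  [DiscreteTopology G]

/-- The regular cover defined by a system of bands whose crossings are labelled by elements of a
group. -/
def regularCover [PathConnectedSpace (B.Total x)] : RegularCover S where
  E := B.Total x
  p := ⟨(B.bundle x).proj, (B.bundle x).continuous_proj⟩
  surjective z := ⟨B.point x z 1, rfl⟩
  isCovering := B.isCoveringMap_proj x
  regular e e' h := by
    obtain ⟨w, hw⟩ := B.exists_point x e
    obtain ⟨w', hw'⟩ := B.exists_point x e'
    refine ⟨_, (B.leftMulDeck x (w' * w⁻¹)).2, ?_⟩
    have h : e.proj = e'.proj := h
    rw [hw, leftMulDeck_point, inv_mul_cancel_right, hw', h]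

/-- `G` acts simply transitively on one fibre, and a deck transformation is determined by the image
of one point. -/
theorem bijective_leftMulDeck [PathConnectedSpace (B.Total x)] [Nonempty S] :
    Function.Bijective (B.leftMulDeck x : G → (B.regularCover x).Deck) := by
  let z : S := Classical.arbitrary S
  let e : (B.regularCover x).E := B.point x z 1
  constructor
  · intro k l h
    have h1 : (B.leftMulDeck x k : B.Total x ≃ₜ B.Total x) (B.point x z 1) =
        (B.leftMulDeck x l : B.Total x ≃ₜ B.Total x) (B.point x z 1) :=
      congrArg (fun d : (B.regularCover x).Deck => d • e) h
    simp only [leftMulDeck_point, mul_one] at h1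
    exact B.point_injective x z h1
  · intro (d : (B.regularCover x).Deck)
    obtain ⟨k, hk⟩ := B.exists_point x (d • e)
    refine ⟨k, RegularCover.deck_ext (e := e) ?_⟩
    refine (B.leftMulDeck_point x k z 1).trans ?_
    rw [mul_one]
    refine Eq.trans ?_ hk.symm
    congr 1
    exact ((B.regularCover x).p_deck_smul d e).symm

/-- The deck transformation group of the cover. -/
def deckEquiv [PathConnectedSpace (B.Total x)] [Nonempty S] : G ≃* (B.regularCover x).Deck :=
  MulEquiv.ofBijective (B.leftMulDeck x) (B.bijective_leftMulDeck x)

/-- The tile of `h` lifts the loop; `h` is a free parameter, chosen to make the lift start at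
coordinate `1`. -/
theorem deckOfLoop_deckEquiv [PathConnectedSpace (B.Total x)] [Nonempty S] (c : C(I, X)) {z : S}
    (h k : G) (h0 : B.q (c 0) = z) (h1 : B.q (c 1) = z) (hs0 : h * B.tileShift x (c 0) = 1)
    (hs1 : h * B.tileShift x (c 1) = k) :
    (B.regularCover x).DeckOfLoop (B.point x z 1) (B.q.comp c) (B.deckEquiv x k) := by
  refine ⟨⟨fun t => B.tile x h (c t), (B.continuous_tile x h).comp c.continuous⟩,
    fun _ => rfl, ?_, ?_⟩
  · change B.point x (B.q (c 0)) (h * B.tileShift x (c 0)) = _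
    rw [h0, hs0]
  · change B.point x (B.q (c 1)) (h * B.tileShift x (c 1)) = _
    rw [h1, hs1]
    exact ((B.leftMulDeck_point x k z 1).trans (by rw [mul_one])).symm

end BandSystem

/-! ### Covers with prescribed deck groups. -/

open StandardSurface in
theorem exists_regularCover_of_generators {g : ℕ} (hg : 0 < g) {S : Type u} [TopologicalSpace S]
    (h : StandardSurface g ≃ₜ S) {G : Type v} [Group G] [Countable G] (x : Fin g → G)
    (hx : Subgroup.closure (Set.range x) = ⊤) :
    ∃ (C : RegularCover S) (ι : G ≃* C.Deck) (e₀ : C.E), ∀ i : Fin g,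
      C.DeckOfLoop e₀ ((h : C(StandardSurface g, S)).comp (loopA g i)) (ι (x i)) ∧
      C.DeckOfLoop e₀ ((h : C(StandardSurface g, S)).comp (loopB g i)) 1 := by
  -- The total space must live in the universe of `S`, so the countable group is replaced by a copy
  -- there.
  have : Small.{u} G := inferInstance
  let e : G ≃* Shrink.{u} G := Shrink.mulEquiv.symm
  let y : Fin g → Shrink.{u} G := e ∘ x
  have hy : Subgroup.closure (Set.range y) = ⊤ := by
    have := congrArg (Subgroup.map e.toMonoidHom) hx
    rw [MonoidHom.map_closure, ← Set.range_comp,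
      Subgroup.map_top_of_surjective _ e.surjective] at this
    exact this
  let _ : TopologicalSpace (Shrink.{u} G) := ⊥
  have : DiscreteTopology (Shrink.{u} G) := ⟨rfl⟩
  let B := bandSystem g h
  have : PathConnectedSpace Disc :=
    isPathConnected_iff_pathConnectedSpace.1
      ((convex_closedBall (0 : ℂ) 1).isPathConnected ⟨0, by simp⟩)
  have hq (i : Fin g) {s : ℝ} (hs : s = 0 ∨ s = 1 ∨ s = 2) :
      B.q (boundaryPoint g (4 * (i : ℕ) + s)) = B.q (boundaryPoint g 0) := by
    refine congrArg h ?_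
    rcases hs with rfl | rfl | rfl
    · rw [add_zero]; exact mk_boundaryPoint_eq i
    · exact (mk_boundaryPoint_corner i).2.2.1.trans (mk_boundaryPoint_eq i)
    · exact (mk_boundaryPoint_corner i).2.1.trans (mk_boundaryPoint_eq i)
  have h1 (i : Fin g) {s : ℝ} (hs : s ∈ I) :
      B.tileShift y (boundaryPoint g (4 * (i : ℕ) + 1 + s)) = y i :=
    B.tileShift_eq y (by
      change 1 / 2 ≤ bandHeight g i _
      rw [bandHeight_boundaryPoint_eq_one hs]; norm_num)
  have h0 (i : Fin g) : B.tileShift y (boundaryPoint g (4 * (i : ℕ))) = 1 :=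
    B.tileShift_eq_one y fun j => by
      change bandHeight g j _ < 1 / 2
      rw [bandHeight_corner]; norm_num
  have : PathConnectedSpace (B.Total y) := by
    refine B.pathConnectedSpace_total hy (boundaryPoint g 0) (fun i => ?_)
      (fun i => boundaryPoint g (4 * (i : ℕ) + 1)) (fun i => ?_) (fun i => hq i (by simp))
    · have := bandHeight_corner ⟨0, hg⟩ i
      simp only [Nat.cast_zero, mul_zero] at this
      exact this
    · have := bandHeight_boundaryPoint_eq_one (i := i) (s := 0) (by simp)
      rw [add_zero] at this
      exact this
  have : Nonempty S := ⟨B.q (boundaryPoint g 0)⟩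
  refine ⟨B.regularCover y, e.trans (B.deckEquiv y),
    B.point y (B.q (boundaryPoint g 0)) 1, fun i => ⟨?_, ?_⟩⟩
  · refine B.deckOfLoop_deckEquiv y ⟨fun s => boundaryPoint g (4 * (i : ℕ) + (s : ℝ)),
      (continuous_boundaryPoint g).comp (by fun_prop)⟩ 1 (y i) (hq i (by simp)) (hq i (by simp))
      ?_ ?_
    · simpa using h0 i
    · simpa using h1 i (s := 0) (by simp)
  · rw [← map_one (B.deckEquiv y)]
    -- All of the side `bᵢ` has `tileShift` equal to `y i`, hence the tile `(y i)⁻¹` and the trivial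
    -- deck transformation.
    refine B.deckOfLoop_deckEquiv y ⟨fun s => boundaryPoint g (4 * (i : ℕ) + 1 + (s : ℝ)),
      (continuous_boundaryPoint g).comp (by fun_prop)⟩ (y i)⁻¹ 1 ?_ ?_ ?_ ?_
    · simpa using hq i (s := 1) (by simp)
    · refine Eq.trans (congrArg (fun t => B.q (boundaryPoint g t)) ?_) (hq i (s := 2) (by simp))
      rw [Set.Icc.coe_one]
      ring
    · rw [inv_mul_eq_one]; exact (h1 i (s := ((0 : I) : ℝ)) (0 : I).2).symm
    · rw [inv_mul_eq_one]; exact (h1 i (s := ((1 : I) : ℝ)) (1 : I).2).symm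

theorem exists_regularCover_of_ne_one {g : ℕ} [Nontrivial (Fin g)] {S : Type u}
    [TopologicalSpace S] (h : StandardSurface g ≃ₜ S) {G : Type v} [Group G] [Group.FG G] {x : G}
    (hx : x ≠ 1) (i : Fin g) :
    ∃ (C : RegularCover S) (ι : G →* C.Deck) (e₀ : C.E), Function.Injective ι ∧
      C.DeckOfLoop e₀ ((h : C(StandardSurface g, S)).comp (loopA g i)) (ι x) ∧
      ∃ u : C.Deck, Subgroup.closure {ι x, u} = ⊤ := by
  obtain ⟨D, _, _, ι, t, hι, ht⟩ := exists_two_generator_overgroup hx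
  -- Band `i` carries `x`; all other bands carry `t`, and there is at least one of them.
  let y : Fin g → D := fun j => if j = i then ι x else t
  have hyi : y i = ι x := if_pos rfl
  have hy : Set.range y = {ι x, t} := by
    refine Set.Subset.antisymm ?_ ?_
    · rintro _ ⟨j, rfl⟩
      by_cases hj : j = i <;> simp [y, hj]
    · rintro _ (rfl | rfl)
      · exact ⟨i, hyi⟩
      · obtain ⟨j, hj⟩ := exists_ne i
        exact ⟨j, if_neg hj⟩
  obtain ⟨C, κ, e₀, hC⟩ := exists_regularCover_of_generators i.pos h y (hy ▸ ht)
  refine ⟨C, κ.toMonoidHom.comp ι, e₀, κ.injective.comp hι, ?_, κ t, ?_⟩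
  · have := (hC i).1
    rwa [hyi] at this
  · have := congrArg (Subgroup.map κ.toMonoidHom) ht
    rw [MonoidHom.map_closure, Subgroup.map_top_of_surjective _ κ.surjective,
      Set.image_pair] at this
    exact this

end

theorem corollary3p1 (g : ℕ) (hg : 2 ≤ g) (S : Type u) [TopologicalSpace S]
    (h : StandardSurface g ≃ₜ S) (G : Type v) [Group G] [Group.IsFinitelyPresented G] :
    -- The deck transformation group of a regular cover is the quotient of the fundamental group
    -- of `S` by that of the cover. (The opposite group appears because the product `x * y` in
    -- `FundamentalGroup` runs through `y` first.)
    (∀ (C : RegularCover S) (e₀ : C.E),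
      ∃ φ : FundamentalGroup S (C.p e₀) →* (C.Deck)ᵐᵒᵖ,
        (∀ (γ : Path (C.p e₀) (C.p e₀)) (d : C.Deck),
          φ (FundamentalGroup.fromPath (Path.Homotopic.Quotient.mk γ)) = MulOpposite.op d ↔
            C.DeckOfLoop e₀ γ.toContinuousMap d) ∧
        Function.Surjective φ ∧
        φ.ker = (FundamentalGroup.map C.p e₀).range) ∧
    -- `G` embeds in the deck transformation group of a regular cover, which may be taken to be a
    -- 2-generator group.
    (∃ (C : RegularCover S) (ι : G →* C.Deck), Function.Injective ι ∧
      ∃ t u : C.Deck, Subgroup.closure {t, u} = ⊤) ∧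
    -- A chosen nontrivial element of `G` can be sent to the image of the standard generator `a₀`,
    -- and to one of two generators of the deck transformation group.
    (∀ x : G, x ≠ 1 →
      ∃ (C : RegularCover S) (ι : G →* C.Deck) (e₀ : C.E), Function.Injective ι ∧
        C.DeckOfLoop e₀ ((h : C(StandardSurface g, S)).comp (loopA g ⟨0, by omega⟩)) (ι x) ∧
        ∃ u : C.Deck, Subgroup.closure {ι x, u} = ⊤) ∧
    -- If `G` is generated by at most `g` elements, it is itself a deck transformation group, with
    -- the generators of `G` being the images of the standard generators `aᵢ`.
    (∀ x : Fin g → G, Subgroup.closure (Set.range x) = ⊤ →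
      ∃ (C : RegularCover S) (ι : G ≃* C.Deck) (e₀ : C.E),
        ∀ i : Fin g,
          C.DeckOfLoop e₀ ((h : C(StandardSurface g, S)).comp (loopA g i)) (ι (x i)) ∧
          C.DeckOfLoop e₀ ((h : C(StandardSurface g, S)).comp (loopB g i)) 1) := by
  have : Group.FG G := by
    obtain ⟨n, φ, hφ, -⟩ := Group.IsFinitelyPresented.out (G := G)
    exact Group.fg_of_surjective hφ
  have : Countable G := Group.FG.countable G
  have hg0 : 0 < g := two_pos.trans_le hg
  have : Nontrivial (Fin g) := Fin.nontrivial_iff_two_le.2 hg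
  refine ⟨fun C e₀ => C.exists_fundamentalGroup_hom e₀, ?_,
    fun x hx => exists_regularCover_of_ne_one h hx _,
    fun x hx => exists_regularCover_of_generators hg0 h x hx⟩
  by_cases hG : ∃ x : G, x ≠ 1
  · obtain ⟨x, hx⟩ := hG
    obtain ⟨C, ι, -, hι, -, w, hw⟩ := exists_regularCover_of_ne_one h hx ⟨0, hg0⟩
    exact ⟨C, ι, hι, ι x, w, hw⟩
  -- For trivial `G` there is no `x` to use; trivial labels give a trivial deck group.
  · push Not at hG
    have hsub : Subsingleton G := ⟨fun a b => (hG a).trans (hG b).symm⟩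
    obtain ⟨C, ι, -, -⟩ := exists_regularCover_of_generators hg0 h (fun _ : Fin g => (1 : G))
      (Subsingleton.elim _ _)
    have hsub' : Subsingleton C.Deck := ι.symm.injective.subsingleton
    exact ⟨C, ι.toMonoidHom, ι.injective, 1, 1, Subsingleton.elim _ _⟩
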